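/- Let $\mathbb{D}$ be the open unit disc, $\mathbb{T}$ the unit circle, $m$ the normalized Lebesgue measure on $\mathbb{T}$, and let $H^2$ be the Hardy space of the holomorphic functions $f(z)=\sum_{n\ge 0}a_nz^n$ on $\mathbb{D}$ with $\|f\|^2=\sum_{n\ge0}|a_n|^2<\infty$. Let $\varphi\in H^2$ be an inner function (its non-tangential boundary values exist and have modulus one $m$-almost everywhere) with $\varphi(0)=0$, and let $P_\varphi$ be the orthogonal projection of $H^2$ onto the model space $H^2\ominus\varphi H^2$. Let $\alpha\in\mathbb{T}$ and let $\mu_\alpha^\varphi$ be the Clark measure of $\varphi$ at $\alpha$, that is, the unique finite positive Borel measure on $\mathbb{T}$ such that $$\operatorname{Re}\left(\frac{\alpha+\varphi(z)}{\alpha-\varphi(z)}\right)=\int_{\mathbb{T}}\frac{1-|z|^2}{|\zeta-z|^2}\,d\mu_\alpha^\varphi(\zeta)\qquad(z\in\mathbb{D}).$$ Let $e_n(\zeta)=\zeta^n$ ($n\ge 0$) in $L^2(\mathbb{T},\mu_\alpha^\varphi)$, and let $(g_n^{(\alpha)})_{n\ge0}$ be the sequence in $L^2(\mathbb{T},\mu_\alpha^\varphi)$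 that the Kaczmarz algorithm associates with $(e_n)$: $$g_0^{(\alpha)}=e_0,\qquad g_n^{(\alpha)}=e_n-\sum_{k=0}^{n-1}\langle e_n,e_k\rangle\, g_k^{(\alpha)},$$ where $\langle\cdot,\cdot\rangle$ is linear in its first argument. Then $(g_n^{(\alpha)})_{n\ge0}$ is a Parseval frame for $L^2(\mathbb{T},\mu_\alpha^\varphi)$, i.e. $\sum_{n\ge0}|\langle f,g_n^{(\alpha)}\rangle|^2=\|f\|^2$ for every $f$, and for every $n\ge0$ and $\mu_\alpha^\varphi$-almost every $\zeta\in\mathbb{T}$ the non-tangential limit of $P_\varphi(z^n)$ at $\zeta$ exists and $$g_n^{(\alpha)}(\zeta)=\lim_{\angle w\to\zeta}P_\varphi(z^n)(w).$$ -/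

import Mathlib

open MeasureTheory Filter Topology

noncomputable section

/-! ### The unit circle -/

/-- The unit circle carries its Borel σ-algebra. -/
instance instMeasurableSpaceUnitCircle : MeasurableSpace Circle := borel Circle

instance instBorelSpaceUnitCircle : BorelSpace Circle := ⟨rfl⟩

/-- Normalized Lebesgue measure `m` on the unit circle, of total mass one. -/
def circleLebesgue : Measure Circle :=
  (ENNReal.ofReal (2 * Real.pi))⁻¹ •
    Measure.map (fun θ : ℝ => Circle.exp θ) (volume.restrict (Set.Ioc 0 (2 * Real.pi)))

/-- The non-tangential approach region (Stolz region) of aperture `C` at `ω`. It is empty for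
`C ≤ 1`. -/
def approachRegion (C : ℝ) (ω : Circle) : Set ℂ :=
  {z : ℂ | ‖z‖ < 1 ∧ ‖z - (ω : ℂ)‖ < C * (1 - ‖z‖)}

/-- `f` (a function on the open unit disc) has non-tangential limit `c` at `ω`: `f z → c` as
`z → ω` inside every non-tangential approach region at `ω`. -/
def HasNontangentialLimit (f : ℂ → ℂ) (ω : Circle) (c : ℂ) : Prop :=
  ∀ C : ℝ, Tendsto f (𝓝[approachRegion C ω] (ω : ℂ)) (𝓝 c)

/-! ### The Hardy space of the disc, inner functions, model spaces -/

/-- The Hardy space `H²(𝔻)`: the element with Taylor coefficients `(aₙ) ∈ ℓ²(ℕ)` is the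
holomorphic function `z ↦ ∑ aₙ zⁿ` on the open unit disc, see `HardySpace.eval`; the norm and the
inner product are those of `ℓ²(ℕ)`. -/
abbrev HardySpace : Type := lp (fun _ : ℕ => ℂ) 2

/-- The holomorphic function on the open unit disc defined by an element of the Hardy space. -/
def HardySpace.eval (f : HardySpace) (z : ℂ) : ℂ := ∑' n : ℕ, f n * z ^ n

/-- The series defining `HardySpace.eval` converges in the open unit disc. -/
theorem HardySpace.summable_eval (f : HardySpace) {z : ℂ} (hz : ‖z‖ < 1) :
    Summable (fun n : ℕ => f n * z ^ n) := by
  refine Summable.of_norm_bounded (g := fun n : ℕ => ‖f‖ * ‖z‖ ^ n)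
    ((summable_geometric_of_lt_one (norm_nonneg z) hz).mul_left ‖f‖) (fun n => ?_)
  rw [norm_mul, norm_pow]
  exact mul_le_mul_of_nonneg_right (lp.norm_apply_le_norm two_ne_zero f n) (by positivity)

/-- The monomial `zⁿ` as an element of the Hardy space. -/
def HardySpace.monomial (n : ℕ) : HardySpace := lp.single 2 n (1 : ℂ)

/-- An inner function: an element of `H²` whose non-tangential boundary values exist and have
modulus one at almost every point of the circle. -/
def IsInnerFunction (φ : HardySpace) : Prop :=
  ∀ᵐ ω ∂circleLebesgue, ∃ c : ℂ, ‖c‖ = 1 ∧ HasNontangentialLimit φ.eval ω c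

/-- The subspace `φ H² = {φ g : g ∈ H²}` of `H²` (the products being products of functions on the
open unit disc). -/
def HardySpace.multiples (φ : HardySpace) : Submodule ℂ HardySpace where
  carrier := {f | ∃ g : HardySpace, ∀ z : ℂ, ‖z‖ < 1 → f.eval z = φ.eval z * g.eval z}
  zero_mem' := ⟨0, fun z _ => by simp [HardySpace.eval]⟩
  add_mem' := by
    have hadd : ∀ (a b : HardySpace) (z : ℂ), ‖z‖ < 1 →
        (a + b).eval z = a.eval z + b.eval z := by
      intro a b z hz
      unfold HardySpace.eval
      rw [← (a.summable_eval hz).tsum_add (b.summable_eval hz)]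
      simp [add_mul]
    rintro a b ⟨g, hg⟩ ⟨h, hh⟩
    refine ⟨g + h, fun z hz => ?_⟩
    rw [hadd a b z hz, hadd g h z hz, hg z hz, hh z hz, mul_add]
  smul_mem' := by
    have hsmul : ∀ (c : ℂ) (a : HardySpace) (z : ℂ), (c • a).eval z = c * a.eval z := by
      intro c a z
      unfold HardySpace.eval
      rw [← tsum_mul_left]
      simp [mul_assoc]
    rintro c a ⟨g, hg⟩
    refine ⟨c • g, fun z hz => ?_⟩
    rw [hsmul, hsmul, hg z hz]
    ring

/-- The model space `H² ⊖ φ H²`. -/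
abbrev modelSpace (φ : HardySpace) : Submodule ℂ HardySpace := (HardySpace.multiples φ)ᗮ

/-- The orthogonal projection `P_φ` of `H²` onto the model space `H² ⊖ φ H²`. -/
def modelProjection (φ : HardySpace) : HardySpace →L[ℂ] HardySpace :=
  (modelSpace φ).starProjection

/-! ### Clark measures -/

/-- `μ` is the Clark measure of `φ : 𝔻 → 𝔻` at `α`: the (finite, positive) measure on the circle
whose Poisson integral is the positive harmonic function `Re ((α + φ) / (α - φ))`. By Herglotz's
theorem there is exactly one such measure. -/
def IsClarkMeasure (φ : ℂ → ℂ) (α : Circle) (μ : Measure Circle)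
    [IsFiniteMeasure μ] : Prop :=
  ∀ z : ℂ, ‖z‖ < 1 →
    (((α : ℂ) + φ z) / ((α : ℂ) - φ z)).re =
      ∫ ζ : Circle, (1 - ‖z‖ ^ 2) / ‖(ζ : ℂ) - z‖ ^ 2 ∂μ

/-! ### The Kaczmarz algorithm and Parseval frames -/

/-- The sequence attached to `(eₙ)` by the Kaczmarz algorithm:
`γ₀ = e₀` and `γₙ = eₙ - ∑_{k < n} ⟨eₙ, eₖ⟩ γₖ`. Here `⟨x, y⟩` is linear in `x`, that is,
`⟨x, y⟩ = inner ℂ y x`. -/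
def kaczmarzSequence {H : Type*} [NormedAddCommGroup H] [InnerProductSpace ℂ H] (e : ℕ → H) :
    ℕ → H
  | n => e n - ∑ k : Fin n, inner ℂ (e k) (e n) • kaczmarzSequence e k
termination_by n => n
decreasing_by exact k.2

/-- `(gₙ)` is a Parseval frame: `∑ |⟨f, gₙ⟩|² = ‖f‖²` for every `f`. -/
def IsParsevalFrame {H : Type*} [NormedAddCommGroup H] [InnerProductSpace ℂ H] (g : ℕ → H) :
    Prop :=
  ∀ f : H, HasSum (fun n => ‖inner ℂ (g n) f‖ ^ 2) (‖f‖ ^ 2)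

/-- The monomial `ζ ↦ ζⁿ` as an element of `L²(𝕋, μ)`. -/
def monomialL2 (μ : Measure Circle) [IsFiniteMeasure μ] (n : ℕ) : Lp ℂ 2 μ :=
  ContinuousMap.toLp 2 μ ℂ (⟨fun ζ : Circle => (ζ : ℂ) ^ n, by fun_prop⟩ : C(Circle, ℂ))

end

/-!
The theorem has an elementary proof which needs neither Poltoratski's theorem nor the theory of
effective sequences for singular measures.

Write `φ = ∑ aₖ zᵏ` and `ψ = conj α φ = ∑ bₖ zᵏ`, so `b₀ = 0`. The Clark identity forces `|φ| < 1`
on the disc and `μ(𝕋) = 1`, and it identifies the Cauchy transform `F(z) = ∑ ⟨e₀, eₙ⟩ zⁿ` of `μ`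
with `1 / (1 - ψ)` (`IsClarkMeasure.integral_cauchyKernel`). Hence the coefficients of `1 - ψ` are,
up to conjugation, those of the inverse of the lower triangular Toeplitz matrix of correlations
which defines the Kaczmarz sequence, and `gₙ = eₙ - ∑_{1 ≤ k ≤ n} conj bₖ e_{n-k}`
(`kaczmarzSequence_eq_of_stationary`).

*Parseval frame.* The operator `T f = (⟨f, gₙ⟩)ₙ` is a contraction into `ℓ²`, because the error of
the Kaczmarz algorithm after `N` steps has square norm `‖f‖² - ∑_{n < N} |⟨f, gₙ⟩|²`. Moreover
`T e₋₁ = (b₁, b₂, …)`, which has norm `‖φ‖ = 1` since `φ` is inner. A contraction which preserves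
the norm of a vector `y` preserves inner products with `y` (`inner_eq_of_norm_add_smul_le`);
together with stationarity this gives `‖T eₖ₊₁‖ = ‖T eₖ‖` for every integer `k`. So `T` is isometric
at every `eₖ`, and trigonometric polynomials are dense
(`isParsevalFrame_kaczmarzSequence_of_stationary`).

*Boundary values.* The same principle, applied to multiplication by `φ` on `H²`, gives
`P_φ zⁿ = zⁿ - φ ∑_{k ≤ n} conj aₖ z^{n-k}` (`modelProjection_monomial`), a formula which becomes
`gₙ` on replacing `φ` by `α`. It remains to see that `φ` tends non-tangentially to `α` at `μ`-almost
every point. The Poisson integral of `μ` is `(1 - |φ|²) / |α - φ|²`, and in a Stolz region it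
dominates the averages of `μ` over discs. The set `{φ = α}` of the circle is Lebesgue null
(`IsInnerFunction.ae_ne`), so the Poisson integral tends to zero along almost every radius, and by
Besicovitch's differentiation theorem `μ` is singular (`IsClarkMeasure.mutuallySingular`).
Differentiating Lebesgue measure with respect to `μ`, the averages of `μ` tend to infinity
`μ`-almost everywhere, hence so does the Poisson integral, and `|α - φ| → 0`
(`IsClarkMeasure.ae_hasNontangentialLimit`).
-/

/-! ### The Kaczmarz algorithm for a stationary sequence -/

theorem lp.hasSum_norm_sq (f : lp (fun _ : ℕ => ℂ) 2) :
    HasSum (fun n => ‖f n‖ ^ 2) (‖f‖ ^ 2) := by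
  have h := lp.hasSum_norm (p := 2) (by norm_num) f
  simpa using h

/-- If `x + t y ↦ x' + t y'` is a contraction which preserves the norm of `y`, then it preserves
the inner product of `y` with `x`. -/
theorem inner_eq_of_norm_add_smul_le {E F : Type*} [NormedAddCommGroup E] [InnerProductSpace ℂ E]
    [NormedAddCommGroup F] [InnerProductSpace ℂ F] {x y : E} {x' y' : F}
    (h : ∀ t : ℂ, ‖x' + t • y'‖ ≤ ‖x + t • y‖) (hy : ‖y'‖ = ‖y‖) :
    inner ℂ x' y' = inner ℂ x y := by
  set δ : ℂ := inner ℂ x' y' - inner ℂ x y with hδ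
  -- The first-order term in `t`, for `t = s * conj δ`, is bounded independently of `s`.
  have key : ∀ s : ℝ, 2 * s * ‖δ‖ ^ 2 ≤ ‖x‖ ^ 2 - ‖x'‖ ^ 2 := by
    intro s
    have h1 := pow_le_pow_left₀ (norm_nonneg _) (h (s * starRingEnd ℂ δ)) 2
    rw [norm_add_sq (𝕜 := ℂ), norm_add_sq (𝕜 := ℂ), norm_smul, norm_smul, hy, inner_smul_right,
      inner_smul_right] at h1
    have h2 : (s * starRingEnd ℂ δ * inner ℂ x' y').re - (s * starRingEnd ℂ δ * inner ℂ x y).re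
        = s * ‖δ‖ ^ 2 := by
      rw [← Complex.sub_re, ← mul_sub, ← hδ, mul_assoc, mul_comm (starRingEnd ℂ δ),
        Complex.mul_conj, Complex.normSq_eq_norm_sq, ← Complex.ofReal_mul, Complex.ofReal_re]
    simp only [RCLike.re_eq_complex_re] at h1
    linarith
  have hδ0 : ‖δ‖ ^ 2 = 0 := by
    by_contra hne
    have hpos : 0 < ‖δ‖ ^ 2 := lt_of_le_of_ne (by positivity) (Ne.symm hne)
    have := key ((‖x‖ ^ 2 - ‖x'‖ ^ 2 + 1) / ‖δ‖ ^ 2)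
    rw [mul_assoc, div_mul_cancel₀ _ hne] at this
    have h0 := key 0
    linarith
  have : δ = 0 := by simpa using hδ0
  exact sub_eq_zero.mp this

section Kaczmarz

variable {H : Type*} [NormedAddCommGroup H] [InnerProductSpace ℂ H]

theorem kaczmarzSequence_eq (e : ℕ → H) (n : ℕ) :
    kaczmarzSequence e n =
      e n - ∑ k ∈ Finset.range n, inner ℂ (e k) (e n) • kaczmarzSequence e k := by
  rw [kaczmarzSequence, Finset.sum_range]

/-- The error of the Kaczmarz algorithm after `N` steps. -/
theorem norm_sq_sub_sum_kaczmarzSequence {e : ℕ → H} (he : ∀ n, ‖e n‖ = 1) (f : H) (N : ℕ) :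
    ‖f - ∑ n ∈ Finset.range N, inner ℂ (kaczmarzSequence e n) f • e n‖ ^ 2 =
      ‖f‖ ^ 2 - ∑ n ∈ Finset.range N, ‖inner ℂ (kaczmarzSequence e n) f‖ ^ 2 := by
  induction N with
  | zero => simp
  | succ N ih =>
    rw [Finset.sum_range_succ, Finset.sum_range_succ, ← sub_sub, ← sub_sub, ← ih]
    set r := f - ∑ n ∈ Finset.range N, inner ℂ (kaczmarzSequence e n) f • e n with hr
    -- The algorithm corrects the error `r` by its component along `e N`.
    have h1 : inner ℂ (e N) r = inner ℂ (kaczmarzSequence e N) f := by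
      rw [kaczmarzSequence_eq e N, hr, inner_sub_right, inner_sub_left, inner_sum, sum_inner]
      congr 1
      refine Finset.sum_congr rfl fun k _ => ?_
      rw [inner_smul_right, inner_smul_left, inner_conj_symm, mul_comm]
    rw [← h1, norm_sub_sq (𝕜 := ℂ), inner_smul_right, norm_smul, he, ← inner_conj_symm r,
      Complex.mul_conj, Complex.normSq_eq_norm_sq]
    simp only [RCLike.re_eq_complex_re, Complex.ofReal_re]
    ring

/-- The analysis operator `f ↦ (⟨f, gₙ⟩)ₙ` of a Bessel sequence of bound one. -/
noncomputable def analysisOperator (g : ℕ → H)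
    (hg : ∀ (f : H) (N : ℕ), ∑ n ∈ Finset.range N, ‖inner ℂ (g n) f‖ ^ 2 ≤ ‖f‖ ^ 2) :
    H →L[ℂ] lp (fun _ : ℕ => ℂ) 2 :=
  LinearMap.mkContinuous
    { toFun := fun f => ⟨fun n => inner ℂ (g n) f, memℓp_gen (by
        simpa using summable_of_sum_range_le (fun n => sq_nonneg ‖inner ℂ (g n) f‖) (hg f))⟩
      map_add' := fun f f' => by ext n; exact inner_add_right _ _ _
      map_smul' := fun t f => by ext n; exact inner_smul_right _ _ _ } 1 (fun f => by
        rw [one_mul]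
        refine (sq_le_sq₀ (norm_nonneg _) (norm_nonneg _)).mp ?_
        exact le_of_tendsto' (lp.hasSum_norm_sq _).tendsto_sum_nat (hg f))

@[simp]
theorem analysisOperator_apply (g : ℕ → H)
    (hg : ∀ (f : H) (N : ℕ), ∑ n ∈ Finset.range N, ‖inner ℂ (g n) f‖ ^ 2 ≤ ‖f‖ ^ 2)
    (f : H) (n : ℕ) : analysisOperator g hg f n = inner ℂ (g n) f := rfl

theorem norm_analysisOperator_le (g : ℕ → H)
    (hg : ∀ (f : H) (N : ℕ), ∑ n ∈ Finset.range N, ‖inner ℂ (g n) f‖ ^ 2 ≤ ‖f‖ ^ 2)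
    (f : H) : ‖analysisOperator g hg f‖ ≤ ‖f‖ := by
  refine (sq_le_sq₀ (norm_nonneg _) (norm_nonneg _)).mp ?_
  exact le_of_tendsto' (lp.hasSum_norm_sq _).tendsto_sum_nat (hg f)

/-- For a stationary sequence of unit vectors the Kaczmarz sequence is given by the inverse of the
lower triangular Toeplitz matrix of the correlations `c`: the first column of that inverse is
`(1, -conj β₀, -conj β₁, …)`. -/
theorem kaczmarzSequence_eq_of_stationary {e : ℤ → H} {c : ℤ → ℂ} {β : ℕ → ℂ}
    (he : ∀ i j, inner ℂ (e i) (e j) = c (j - i)) (hc0 : c 0 = 1)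
    (hβ : ∀ n : ℕ, ∑ k ∈ Finset.range (n + 1), β k * c (k - n) = c (-(n + 1))) (n : ℕ) :
    kaczmarzSequence (fun m : ℕ => e m) n =
      e n - ∑ k ∈ Finset.range n, starRingEnd ℂ (β k) • e ((n - 1 - k : ℕ) : ℤ) := by
  have hcc : ∀ m : ℤ, starRingEnd ℂ (c m) = c (-m) := by
    intro m
    have h1 := he 0 m
    have h2 := he m 0
    rw [sub_zero] at h1
    rw [zero_sub] at h2
    rw [← h1, ← h2, inner_conj_symm]
  have hβ' : ∀ n : ℕ, starRingEnd ℂ (β n) =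
      c (n + 1) - ∑ k ∈ Finset.range n, starRingEnd ℂ (β k) * c (n - k) := by
    intro n
    have h := congrArg (starRingEnd ℂ) (hβ n)
    rw [map_sum, hcc, neg_neg, Finset.sum_range_succ] at h
    rw [← h]
    simp [hcc, hc0]
  induction n using Nat.strong_induction_on with
  | _ n ih =>
    rw [kaczmarzSequence_eq]
    congr 1
    have h1 : ∀ k ∈ Finset.range n,
        inner ℂ (e k) (e n) • kaczmarzSequence (fun m : ℕ => e m) k =
        c (n - k) • e k -
          ∑ i ∈ Finset.range k, (c (n - k) * starRingEnd ℂ (β (k - 1 - i))) • e i := by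
      intro k hk
      rw [ih k (Finset.mem_range.mp hk), he, smul_sub, Finset.smul_sum]
      congr 1
      rw [← Finset.sum_range_reflect]
      refine Finset.sum_congr rfl fun i hi => ?_
      rw [smul_smul]
      have := Finset.mem_range.mp hi
      congr 3
      omega
    rw [Finset.sum_congr rfl h1, Finset.sum_sub_distrib]
    -- After exchanging the sums, the coefficient of each `e i` is an instance of `hβ'`.
    have h2 : ∑ k ∈ Finset.range n, ∑ i ∈ Finset.range k,
          (c (n - k) * starRingEnd ℂ (β (k - 1 - i))) • e i =
        ∑ i ∈ Finset.range n, ∑ k ∈ Finset.Ico (i + 1) n,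
          (c (n - k) * starRingEnd ℂ (β (k - 1 - i))) • e i := by
      refine Finset.sum_comm' fun k i => ?_
      simp only [Finset.mem_range, Finset.mem_Ico]
      omega
    rw [h2, ← Finset.sum_sub_distrib,
      ← Finset.sum_range_reflect (fun k => starRingEnd ℂ (β k) • e ((n - 1 - k : ℕ) : ℤ))]
    refine Finset.sum_congr rfl fun i hi => ?_
    have hi := Finset.mem_range.mp hi
    rw [← Finset.sum_smul, ← sub_smul, hβ' (n - 1 - i), Finset.sum_Ico_eq_sum_range]
    have h3 : n - (i + 1) = n - 1 - i := by omega
    have h4 : n - 1 - (n - 1 - i) = i := by omega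
    have h5 : ((n - 1 - i : ℕ) : ℤ) = n - 1 - i := by omega
    rw [h3, h4, h5]
    congr 2
    · congr 1; ring
    · refine Finset.sum_congr rfl fun k hk => ?_
      have := Finset.mem_range.mp hk
      rw [mul_comm]
      congr 2
      · congr 1; omega
      · push_cast; ring

/-- The Kaczmarz sequence of a stationary sequence `(eₙ)` of unit vectors is a Parseval frame as
soon as the coefficients `β` of the inverse correlation matrix have `ℓ²` norm one. The analysis
operator `T` maps `e₋₁` to `β`, so it is isometric at `e₋₁`; the recursion
`‖T eₖ₊₁‖² = |⟨eₖ, e₋₁⟩|² + ‖T eₖ - ⟨eₖ, e₋₁⟩ T e₋₁‖²` then shows that it is isometric at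
every `eₖ`, hence everywhere. -/
theorem isParsevalFrame_kaczmarzSequence_of_stationary [CompleteSpace H]
    {e : ℤ → H} {c : ℤ → ℂ} {β : ℕ → ℂ}
    (he : ∀ i j, inner ℂ (e i) (e j) = c (j - i)) (hc0 : c 0 = 1)
    (hβ : ∀ n : ℕ, ∑ k ∈ Finset.range (n + 1), β k * c (k - n) = c (-(n + 1)))
    (hβ1 : HasSum (fun n => ‖β n‖ ^ 2) 1)
    (hd : Dense (Submodule.span ℂ (Set.range e) : Set H)) :
    IsParsevalFrame (kaczmarzSequence fun n : ℕ => e n) := by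
  have hnorm : ∀ k, ‖e k‖ = 1 := by
    intro k
    have h := he k k
    rw [sub_self, hc0, inner_self_eq_norm_sq_to_K] at h
    have h' : ‖e k‖ ^ 2 = 1 := Complex.ofReal_injective (by push_cast; exact h)
    nlinarith [norm_nonneg (e k)]
  set g := kaczmarzSequence fun n : ℕ => e n with hg
  have hB : ∀ (f : H) (N : ℕ), ∑ n ∈ Finset.range N, ‖inner ℂ (g n) f‖ ^ 2 ≤ ‖f‖ ^ 2 := by
    intro f N
    have := norm_sq_sub_sum_kaczmarzSequence (e := fun n : ℕ => e n) (fun n => hnorm n) f N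
    nlinarith [sq_nonneg ‖f - ∑ n ∈ Finset.range N,
      inner ℂ (kaczmarzSequence (fun n : ℕ => e n) n) f • e n‖]
  set T := analysisOperator g hB with hT
  have hin : ∀ (n : ℕ) (k : ℤ), inner ℂ (g n) (e k) =
      c (k - n) - ∑ j ∈ Finset.range n, β j * c (k - (n - 1 - j)) := by
    intro n k
    rw [hg, kaczmarzSequence_eq_of_stationary he hc0 hβ, inner_sub_left, he, sum_inner]
    congr 1
    refine Finset.sum_congr rfl fun j hj => ?_
    have := Finset.mem_range.mp hj
    rw [inner_smul_left, he, Complex.conj_conj]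
    congr 2
    omega
  -- `T e₋₁ = β`
  have hneg : ∀ n, inner ℂ (g n) (e (-1)) = β n := by
    intro n
    have h := hβ n
    rw [Finset.sum_range_succ, sub_self, hc0, mul_one] at h
    rw [hin, sub_eq_iff_eq_add', show (-1 - n : ℤ) = -(n + 1) by ring, ← h]
    congr 1
    refine Finset.sum_congr rfl fun j _ => ?_
    congr 2
    ring
  -- Shifting `eₖ` shifts the coefficients `⟨eₖ, gₙ⟩`, up to a multiple of `(1, -β₀, -β₁, …)`.
  have hzero : ∀ k, inner ℂ (g 0) (e (k + 1)) = c (k + 1) := by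
    intro k
    simp [hin]
  have hsucc : ∀ (n : ℕ) (k : ℤ), inner ℂ (g (n + 1)) (e (k + 1)) =
      inner ℂ (g n) (e k) - c (k + 1) * β n := by
    intro n k
    rw [hin, hin, Finset.sum_range_succ, ← sub_sub]
    congr 1
    · congr 1
      · congr 1; push_cast; ring
      · refine Finset.sum_congr rfl fun j _ => ?_
        congr 2; push_cast; ring
    · rw [mul_comm]; congr 2; push_cast; ring
  have hTneg : ‖T (e (-1))‖ = 1 := by
    have h := lp.hasSum_norm_sq (T (e (-1)))
    simp only [hT, analysisOperator_apply, hneg] at h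
    have := h.unique hβ1
    rw [← hT] at this
    nlinarith [norm_nonneg (T (e (-1)))]
  have hinner : ∀ y : H, ‖T y‖ = ‖y‖ → ∀ x, inner ℂ (T x) (T y) = inner ℂ x y := by
    intro y hy x
    refine inner_eq_of_norm_add_smul_le (fun t => ?_) hy
    rw [← map_smul, ← map_add]
    exact norm_analysisOperator_le g hB _
  have hstep : ∀ k : ℤ, ‖T (e (k + 1))‖ ^ 2 = ‖T (e k)‖ ^ 2 := by
    intro k
    have h1 := (hasSum_nat_add_iff' 1).mpr (lp.hasSum_norm_sq (T (e (k + 1))))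
    have h2 := lp.hasSum_norm_sq (T (e k - c (k + 1) • e (-1)))
    have h3 : (fun n => ‖T (e (k + 1)) (n + 1)‖ ^ 2) =
        fun n => ‖T (e k - c (k + 1) • e (-1)) n‖ ^ 2 := by
      funext n
      simp only [hT, analysisOperator_apply]
      rw [hsucc, inner_sub_right, inner_smul_right, hneg]
    rw [h3] at h1
    have h4 := h1.unique h2
    have h5 : inner ℂ (T (e k)) (T (e (-1))) = starRingEnd ℂ (c (k + 1)) := by
      rw [hinner _ (hTneg.trans (hnorm _).symm), ← inner_conj_symm, he, sub_neg_eq_add]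
    rw [map_sub, map_smul, norm_sub_sq (𝕜 := ℂ), inner_smul_right, h5, norm_smul, hTneg,
      Complex.mul_conj, Complex.normSq_eq_norm_sq, Finset.sum_range_one] at h4
    simp only [hT, analysisOperator_apply, hzero, RCLike.re_eq_complex_re,
      Complex.ofReal_re] at h4
    rw [hT]
    linarith
  have hall : ∀ k : ℤ, ‖T (e k)‖ ^ 2 = 1 := by
    intro k
    induction k using Int.inductionOn' (b := -1) with
    | zero => rw [hTneg, one_pow]
    | succ k _ ih => rw [hstep, ih]
    | pred k _ ih =>
      have := hstep (k - 1)
      rw [sub_add_cancel] at this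
      rw [← this, ih]
  have hadj : (ContinuousLinearMap.adjoint T).comp T = ContinuousLinearMap.id ℂ H := by
    refine ContinuousLinearMap.ext_on hd ?_
    rintro _ ⟨k, rfl⟩
    refine ext_inner_left ℂ fun x => ?_
    have hk : ‖T (e k)‖ = ‖e k‖ := by
      rw [hnorm]
      nlinarith [hall k, norm_nonneg (T (e k))]
    rw [ContinuousLinearMap.comp_apply, ContinuousLinearMap.adjoint_inner_right,
      ContinuousLinearMap.id_apply, hinner _ hk]
  intro f
  have hf : ‖T f‖ ^ 2 = ‖f‖ ^ 2 := by
    have h : inner ℂ f (ContinuousLinearMap.adjoint T (T f)) = inner ℂ f f :=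
      congrArg (inner ℂ f) (DFunLike.congr_fun hadj f)
    rw [ContinuousLinearMap.adjoint_inner_right, inner_self_eq_norm_sq_to_K,
      inner_self_eq_norm_sq_to_K] at h
    exact_mod_cast h
  rw [← hf]
  exact lp.hasSum_norm_sq (T f)

end Kaczmarz

/-! ### Integration over the unit circle -/

instance isProbabilityMeasure_circleLebesgue : IsProbabilityMeasure circleLebesgue := by
  constructor
  rw [circleLebesgue, Measure.smul_apply,
    Measure.map_apply (by fun_prop) MeasurableSet.univ, Set.preimage_univ,
    Measure.restrict_apply_univ, Real.volume_Ioc, sub_zero, smul_eq_mul]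
  exact ENNReal.inv_mul_cancel (by simp [Real.pi_pos]) ENNReal.ofReal_ne_top

theorem integral_circleLebesgue {E : Type*} [NormedAddCommGroup E] [NormedSpace ℝ E]
    {f : Circle → E} (hf : Continuous f) :
    ∫ ζ, f ζ ∂circleLebesgue =
      (2 * Real.pi)⁻¹ • ∫ θ in (0 : ℝ)..2 * Real.pi, f (Circle.exp θ) := by
  have hexp : Measurable fun θ : ℝ => Circle.exp θ := by fun_prop
  rw [circleLebesgue, integral_smul_measure, intervalIntegral.integral_of_le Real.two_pi_pos.le,
    integral_map hexp.aemeasurable hf.aestronglyMeasurable,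
    ENNReal.toReal_inv, ENNReal.toReal_ofReal Real.two_pi_pos.le]

theorem norm_smul_circle_lt {r : ℝ} (hr0 : 0 ≤ r) (hr1 : r < 1) (ζ : Circle) :
    ‖(r : ℂ) * ζ‖ < 1 := by
  rwa [norm_mul, Complex.norm_real, Real.norm_of_nonneg hr0, Circle.norm_coe, mul_one]

theorem continuous_comp_smul_circle {f : ℂ → ℂ} (hf : ContinuousOn f (Metric.ball 0 1)) {r : ℝ}
    (hr0 : 0 ≤ r) (hr1 : r < 1) : Continuous fun ζ : Circle => f (r * ζ) :=
  hf.comp_continuous (by fun_prop) fun ζ => by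
    rw [mem_ball_zero_iff]; exact norm_smul_circle_lt hr0 hr1 ζ

theorem integral_circle_of_differentiableOn {f : ℂ → ℂ}
    (hf : DifferentiableOn ℂ f (Metric.ball 0 1)) {r : ℝ} (hr0 : 0 ≤ r) (hr1 : r < 1) :
    ∫ ζ : Circle, f (r * ζ) ∂circleLebesgue = f 0 := by
  rw [integral_circleLebesgue (continuous_comp_smul_circle hf.continuousOn hr0 hr1)]
  have h : DiffContOnCl ℂ f (Metric.ball 0 |r|) := by
    refine (hf.mono ?_).diffContOnCl
    refine Metric.closure_ball_subset_closedBall.trans ?_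
    rw [abs_of_nonneg hr0]
    exact Metric.closedBall_subset_ball hr1
  rw [← h.circleAverage, Real.circleAverage]
  simp [circleMap, Circle.coe_exp]

theorem integral_circle_pow {k : ℕ} (hk : k ≠ 0) :
    ∫ ζ : Circle, (ζ : ℂ) ^ k ∂circleLebesgue = 0 := by
  have h := integral_circle_of_differentiableOn (f := fun z => (2 * z) ^ k)
    (by fun_prop) (r := 1 / 2) (by norm_num) (by norm_num)
  simpa [hk] using h

theorem orthonormal_monomialL2_circleLebesgue : Orthonormal ℂ (monomialL2 circleLebesgue) := by
  rw [orthonormal_iff_ite]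
  have key : ∀ i j : ℕ, i < j →
      inner ℂ (monomialL2 circleLebesgue i) (monomialL2 circleLebesgue j) = 0 := by
    intro i j hij
    rw [monomialL2, monomialL2, ContinuousMap.inner_toLp]
    rw [← integral_circle_pow (Nat.sub_ne_zero_of_lt hij)]
    refine integral_congr_ae (Eventually.of_forall fun ζ => ?_)
    have hz : (ζ : ℂ) * starRingEnd ℂ (ζ : ℂ) = 1 := by
      rw [Complex.mul_conj, Circle.normSq_coe, Complex.ofReal_one]
    have : (ζ : ℂ) ^ j = (ζ : ℂ) ^ (j - i) * (ζ : ℂ) ^ i := by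
      rw [← pow_add, Nat.sub_add_cancel hij.le]
    simp only [ContinuousMap.coe_mk, map_pow]
    rw [this, mul_assoc, ← mul_pow, hz, one_pow, mul_one]
  intro i j
  split_ifs with h
  · subst h
    rw [monomialL2, ContinuousMap.inner_toLp]
    have : ∀ ζ : Circle, (ζ : ℂ) ^ i * starRingEnd ℂ ((ζ : ℂ) ^ i) = 1 := by
      intro ζ
      rw [Complex.mul_conj, ← Complex.ofReal_one, Complex.normSq_eq_norm_sq, norm_pow,
        Circle.norm_coe, one_pow, one_pow]
    simp only [ContinuousMap.coe_mk, this, integral_const, probReal_univ, one_smul]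
  · rcases lt_or_gt_of_ne h with h | h
    · exact key i j h
    · rw [← inner_conj_symm, key j i h, map_zero]

/-! ### Functions in the Hardy space -/

theorem differentiableOn_tsum_pow {a : ℕ → ℂ} {C : ℝ} (ha : ∀ n, ‖a n‖ ≤ C) :
    DifferentiableOn ℂ (fun z => ∑' n, a n * z ^ n) (Metric.ball 0 1) := by
  intro z hz
  rw [mem_ball_zero_iff] at hz
  obtain ⟨r, hzr, hr1⟩ := exists_between hz
  have hr0 : 0 ≤ r := (norm_nonneg z).trans hzr.le
  have h : DifferentiableOn ℂ (fun z => ∑' n, a n * z ^ n) (Metric.ball 0 r) := by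
    refine Complex.differentiableOn_tsum_of_summable_norm (u := fun n => C * r ^ n)
      ((summable_geometric_of_lt_one hr0 hr1).mul_left C) (fun n => by fun_prop)
      Metric.isOpen_ball fun n w hw => ?_
    rw [mem_ball_zero_iff] at hw
    rw [norm_mul, norm_pow]
    exact mul_le_mul (ha n) (pow_le_pow_left₀ (norm_nonneg _) hw.le n) (by positivity)
      ((norm_nonneg _).trans (ha n))
  exact (h.differentiableAt (Metric.isOpen_ball.mem_nhds
    (mem_ball_zero_iff.mpr hzr))).differentiableWithinAt

theorem Orthonormal.hasSum_norm_sq {E : Type*} [NormedAddCommGroup E] [InnerProductSpace ℂ E]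
    {v : ℕ → E} (hv : Orthonormal ℂ v) {a : ℕ → ℂ} {x : E} (h : HasSum (fun n => a n • v n) x) :
    HasSum (fun n => ‖a n‖ ^ 2) (‖x‖ ^ 2) := by
  have hcoef : ∀ n, inner ℂ (v n) x = a n := by
    intro n
    have h1 : HasSum (fun k => inner ℂ (v n) (a k • v k)) (inner ℂ (v n) x) :=
      h.mapL (innerSL ℂ (v n))
    refine h1.unique ?_
    have h2 : (fun k => inner ℂ (v n) (a k • v k)) = fun k => if k = n then a n else 0 := by
      funext k
      rw [inner_smul_right, orthonormal_iff_ite.mp hv n k]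
      by_cases h : k = n
      · subst h; simp
      · simp [h, Ne.symm h]
    rw [h2]
    exact hasSum_ite_eq n (a n)
  have h1 : HasSum (fun k => inner ℂ x (a k • v k)) (inner ℂ x x) := h.mapL (innerSL ℂ x)
  have h2 : HasSum (fun k => (inner ℂ x (a k • v k)).re) (inner ℂ x x).re :=
    h1.mapL Complex.reCLM
  have h3 : (inner ℂ x x).re = ‖x‖ ^ 2 := inner_self_eq_norm_sq (𝕜 := ℂ) x
  rw [h3] at h2
  refine h2.congr_fun fun k => ?_
  rw [inner_smul_right, ← inner_conj_symm, hcoef, Complex.mul_conj, Complex.normSq_eq_norm_sq,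
    Complex.ofReal_re]

namespace HardySpace

theorem differentiableOn_eval (f : HardySpace) : DifferentiableOn ℂ f.eval (Metric.ball 0 1) :=
  differentiableOn_tsum_pow fun n => lp.norm_apply_le_norm two_ne_zero f n

/-- Parseval's identity on the circle of radius `r < 1`. -/
theorem hasSum_integral_norm_sq (f : HardySpace) {r : ℝ} (hr0 : 0 ≤ r) (hr1 : r < 1) :
    HasSum (fun n => ‖f n‖ ^ 2 * r ^ (2 * n))
      (∫ ζ : Circle, ‖f.eval (r * ζ)‖ ^ 2 ∂circleLebesgue) := by
  set e : ℕ → C(Circle, ℂ) := fun n => ⟨fun ζ : Circle => (ζ : ℂ) ^ n, by fun_prop⟩ with he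
  have hen : ∀ n, ‖e n‖ ≤ 1 := fun n =>
    (ContinuousMap.norm_le _ zero_le_one).mpr fun ζ => by simp [he, Circle.norm_coe]
  set F : C(Circle, ℂ) := ⟨fun ζ : Circle => f.eval (r * ζ),
    continuous_comp_smul_circle f.differentiableOn_eval.continuousOn hr0 hr1⟩ with hF
  have hsum : Summable fun n => (f n * r ^ n : ℂ) • e n := by
    refine Summable.of_norm_bounded (g := fun n : ℕ => ‖f‖ * r ^ n)
      ((summable_geometric_of_lt_one hr0 hr1).mul_left ‖f‖) fun n => ?_
    rw [norm_smul, norm_mul, norm_pow, Complex.norm_real, Real.norm_of_nonneg hr0]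
    calc ‖f n‖ * r ^ n * ‖e n‖ ≤ ‖f‖ * r ^ n * 1 := by
          gcongr
          · exact lp.norm_apply_le_norm two_ne_zero f n
          · exact hen n
      _ = _ := mul_one _
  -- The Taylor series converges uniformly on the circle of radius `r`, hence in `L²`.
  have hFsum : HasSum (fun n => (f n * r ^ n : ℂ) • e n) F := by
    have h := hsum.hasSum
    convert h using 1
    ext ζ
    have h2 := ((ContinuousMap.evalCLM ℂ ζ).hasSum h).tsum_eq
    simp only [ContinuousMap.evalCLM_apply] at h2
    rw [← h2, hF, ContinuousMap.coe_mk, HardySpace.eval]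
    refine tsum_congr fun n => ?_
    simp only [he, ContinuousMap.smul_apply,
      ContinuousMap.coe_mk, smul_eq_mul]
    ring
  have hxsum : HasSum (fun n => (f n * r ^ n : ℂ) • monomialL2 circleLebesgue n)
      (ContinuousMap.toLp 2 circleLebesgue ℂ F) := by
    have h := hFsum.mapL (ContinuousMap.toLp 2 circleLebesgue ℂ)
    simp only [map_smul] at h
    exact h
  have hsq := orthonormal_monomialL2_circleLebesgue.hasSum_norm_sq hxsum
  have hnorm : ‖ContinuousMap.toLp 2 circleLebesgue ℂ F‖ ^ 2 =
      ∫ ζ : Circle, ‖f.eval (r * ζ)‖ ^ 2 ∂circleLebesgue := by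
    have h : ((‖ContinuousMap.toLp 2 circleLebesgue ℂ F‖ : ℂ)) ^ 2 = _ :=
      (inner_self_eq_norm_sq_to_K (𝕜 := ℂ) (ContinuousMap.toLp 2 circleLebesgue ℂ F)).symm
    rw [ContinuousMap.inner_toLp] at h
    refine Complex.ofReal_injective ?_
    rw [Complex.ofReal_pow, h, ← integral_complex_ofReal]
    refine integral_congr_ae (Eventually.of_forall fun ζ => ?_)
    simp only [hF, ContinuousMap.coe_mk]
    rw [Complex.mul_conj, Complex.normSq_eq_norm_sq]
  rw [hnorm] at hsq
  convert hsq using 2 with n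
  rw [norm_mul, norm_pow, Complex.norm_real, Real.norm_of_nonneg hr0]
  ring

theorem integral_norm_sq_le (f : HardySpace) {r : ℝ} (hr0 : 0 ≤ r) (hr1 : r < 1) :
    ∫ ζ : Circle, ‖f.eval (r * ζ)‖ ^ 2 ∂circleLebesgue ≤ ‖f‖ ^ 2 := by
  refine hasSum_le (fun n => ?_) (f.hasSum_integral_norm_sq hr0 hr1) (lp.hasSum_norm_sq f)
  exact mul_le_of_le_one_right (sq_nonneg _) (pow_le_one₀ hr0 hr1.le)

/-- The radii `1 - 1 / (j + 2)`, which increase to one. -/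
noncomputable def radius (j : ℕ) : ℝ := 1 - 1 / ((j : ℝ) + 2)

theorem radius_nonneg (j : ℕ) : 0 ≤ radius j := by
  rw [radius, sub_nonneg, div_le_one (by positivity)]
  linarith [(Nat.cast_nonneg j : (0 : ℝ) ≤ j)]

theorem radius_lt_one (j : ℕ) : radius j < 1 := by
  rw [radius, sub_lt_self_iff]
  positivity

theorem tendsto_radius : Tendsto radius atTop (𝓝 1) := by
  have h : Tendsto (fun j : ℕ => 1 / ((j : ℝ) + 2)) atTop (𝓝 0) :=
    tendsto_const_nhds.div_atTop
      (tendsto_atTop_add_const_right _ _ tendsto_natCast_atTop_atTop)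
  simpa only [sub_zero] using! tendsto_const_nhds (x := (1 : ℝ)).sub h

/-- If the integrals over the circles of radius `r < 1` are bounded by `C`, so is the square of
the norm. -/
theorem norm_sq_le_of_integral_le (f : HardySpace) {C : ℝ}
    (h : ∀ r : ℝ, 0 ≤ r → r < 1 → ∫ ζ : Circle, ‖f.eval (r * ζ)‖ ^ 2 ∂circleLebesgue ≤ C) :
    ‖f‖ ^ 2 ≤ C := by
  refine le_of_tendsto' (lp.hasSum_norm_sq f).tendsto_sum_nat fun N => ?_
  have h1 : Tendsto (fun j => ∑ n ∈ Finset.range N, ‖f n‖ ^ 2 * radius j ^ (2 * n)) atTop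
      (𝓝 (∑ n ∈ Finset.range N, ‖f n‖ ^ 2 * 1 ^ (2 * n))) :=
    tendsto_finsetSum _ fun n _ => tendsto_const_nhds.mul (tendsto_radius.pow _)
  simp only [one_pow, mul_one] at h1
  refine le_of_tendsto' h1 fun j => ?_
  refine le_trans ?_ (h _ (radius_nonneg j) (radius_lt_one j))
  exact sum_le_hasSum _ (fun n _ => mul_nonneg (sq_nonneg _) (pow_nonneg (radius_nonneg j) _))
    (f.hasSum_integral_norm_sq (radius_nonneg j) (radius_lt_one j))

/-- Multiplication by a function bounded by one is a contraction of the Hardy space. -/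
theorem norm_le_of_eval_eq_mul {φ : ℂ → ℂ} (hφ : ∀ z, ‖z‖ < 1 → ‖φ z‖ ≤ 1) {f g : HardySpace}
    (h : ∀ z, ‖z‖ < 1 → f.eval z = φ z * g.eval z) : ‖f‖ ≤ ‖g‖ := by
  refine (sq_le_sq₀ (norm_nonneg _) (norm_nonneg _)).mp ?_
  refine f.norm_sq_le_of_integral_le fun r hr0 hr1 => ?_
  refine le_trans ?_ (g.integral_norm_sq_le hr0 hr1)
  have hint : ∀ k : HardySpace,
      Integrable (fun ζ : Circle => ‖k.eval (r * ζ)‖ ^ 2) circleLebesgue := fun k =>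
    ((continuous_comp_smul_circle k.differentiableOn_eval.continuousOn hr0 hr1).norm.pow
      2).integrable_of_hasCompactSupport (HasCompactSupport.of_compactSpace _)
  refine integral_mono (hint f) (hint g) fun ζ => ?_
  have hz := norm_smul_circle_lt hr0 hr1 ζ
  simp only
  rw [h _ hz, norm_mul, mul_pow]
  exact mul_le_of_le_one_left (sq_nonneg _) (pow_le_one₀ (norm_nonneg _) (hφ _ hz))

end HardySpace

/-! ### Inner functions bounded by one -/

theorem radius_mul_mem_approachRegion (ω : Circle) (j : ℕ) :
    (HardySpace.radius j : ℂ) * ω ∈ approachRegion 2 ω := by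
  have h0 := HardySpace.radius_nonneg j
  have h1 := HardySpace.radius_lt_one j
  refine ⟨norm_smul_circle_lt h0 h1 ω, ?_⟩
  have h2 : (HardySpace.radius j : ℂ) * ω - ω = -((1 - HardySpace.radius j : ℝ) : ℂ) * ω := by
    push_cast; ring
  rw [h2, norm_mul, norm_neg, Complex.norm_real, Circle.norm_coe, mul_one, norm_mul,
    Complex.norm_real, Circle.norm_coe, mul_one, Real.norm_of_nonneg h0,
    Real.norm_of_nonneg (by linarith)]
  linarith

theorem HasNontangentialLimit.tendsto_radius {f : ℂ → ℂ} {ω : Circle} {c : ℂ}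
    (h : HasNontangentialLimit f ω c) :
    Tendsto (fun j => f (HardySpace.radius j * ω)) atTop (𝓝 c) := by
  refine (h 2).comp (tendsto_nhdsWithin_iff.mpr
    ⟨?_, Eventually.of_forall (radius_mul_mem_approachRegion ω)⟩)
  have h1 : Tendsto (fun j => (HardySpace.radius j : ℂ)) atTop (𝓝 ((1 : ℝ) : ℂ)) :=
    (Complex.continuous_ofReal.tendsto _).comp HardySpace.tendsto_radius
  simpa using h1.mul_const (ω : ℂ)

theorem IsInnerFunction.norm_eq_one {φ : HardySpace} (hφ : IsInnerFunction φ)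
    (hb : ∀ z, ‖z‖ < 1 → ‖φ.eval z‖ < 1) : ‖φ‖ = 1 := by
  have hle : ∀ (j : ℕ) (ζ : Circle), ‖φ.eval (HardySpace.radius j * ζ)‖ ^ 2 ≤ 1 := fun j ζ =>
    pow_le_one₀ (norm_nonneg _)
      (hb _ (norm_smul_circle_lt (HardySpace.radius_nonneg j) (HardySpace.radius_lt_one j) ζ)).le
  have hcont : ∀ j, Continuous fun ζ : Circle => φ.eval (HardySpace.radius j * ζ) := fun j =>
    continuous_comp_smul_circle φ.differentiableOn_eval.continuousOn
      (HardySpace.radius_nonneg j) (HardySpace.radius_lt_one j)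
  have h1 : ‖φ‖ ^ 2 ≤ 1 := by
    refine φ.norm_sq_le_of_integral_le fun r hr0 hr1 => ?_
    have hc := continuous_comp_smul_circle φ.differentiableOn_eval.continuousOn hr0 hr1
    calc ∫ ζ : Circle, ‖φ.eval (r * ζ)‖ ^ 2 ∂circleLebesgue
        ≤ ∫ _ : Circle, (1 : ℝ) ∂circleLebesgue := by
          refine integral_mono ((hc.norm.pow 2).integrable_of_hasCompactSupport
            (HasCompactSupport.of_compactSpace _)) (integrable_const _) fun ζ => ?_
          exact pow_le_one₀ (norm_nonneg _) (hb _ (norm_smul_circle_lt hr0 hr1 ζ)).le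
      _ = 1 := by simp
  have h2 : Tendsto (fun j => ∫ ζ : Circle, ‖φ.eval (HardySpace.radius j * ζ)‖ ^ 2
      ∂circleLebesgue) atTop (𝓝 (∫ _ : Circle, (1 : ℝ) ∂circleLebesgue)) := by
    refine tendsto_integral_of_dominated_convergence (fun _ => 1)
      (fun j => ((hcont j).norm.pow 2).aestronglyMeasurable) (integrable_const _)
      (fun j => Eventually.of_forall fun ζ => ?_) ?_
    · rw [Real.norm_of_nonneg (sq_nonneg _)]
      exact hle j ζ
    · filter_upwards [hφ] with ζ hζ
      obtain ⟨c, hc, hlim⟩ := hζ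
      have := hlim.tendsto_radius.norm.pow 2
      rwa [hc, one_pow] at this
  have h3 : 1 ≤ ‖φ‖ ^ 2 := by
    have h4 := le_of_tendsto' h2 fun j =>
      φ.integral_norm_sq_le (HardySpace.radius_nonneg j) (HardySpace.radius_lt_one j)
    simpa using h4
  nlinarith [norm_nonneg φ]

theorem Complex.norm_one_add_lt_two {u : ℂ} (hu : ‖u‖ = 1) (hu1 : u ≠ 1) : ‖1 + u‖ < 2 := by
  by_contra hge
  have hle := norm_add_le 1 u
  rw [norm_one, hu] at hle
  have h2 : ‖1 + u‖ ^ 2 = 4 := by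
    rw [show ‖1 + u‖ = 2 by linarith]; norm_num
  rw [norm_add_sq (𝕜 := ℂ), norm_one, hu] at h2
  have hre : u.re = 1 := by
    simp at h2
    linarith
  have him : u.im = 0 := by
    have h3 := Complex.sq_norm u
    rw [hu, Complex.normSq_apply, hre] at h3
    nlinarith
  exact hu1 (Complex.ext hre him)

/-- The boundary values of an inner function with `φ 0 = 0` avoid a given `α` almost everywhere.
The mean values of `((1 + conj α φ) / 2) ^ N` are `2 ^ (-N)`, while on the boundary these functions
tend boundedly to the indicator function of `{φ = α}`. -/
theorem IsInnerFunction.ae_ne {φ : HardySpace} (hφ : IsInnerFunction φ)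
    (hb : ∀ z, ‖z‖ < 1 → ‖φ.eval z‖ < 1) (hφ0 : φ.eval 0 = 0) (α : Circle) :
    ∀ᵐ ω ∂circleLebesgue, ∃ c : ℂ, ‖c‖ = 1 ∧ c ≠ α ∧ HasNontangentialLimit φ.eval ω c := by
  classical
  choose! c hc using fun (ω : Circle)
    (h : ∃ c : ℂ, ‖c‖ = 1 ∧ HasNontangentialLimit φ.eval ω c) => h
  have hae : ∀ᵐ ω ∂circleLebesgue, ‖c ω‖ = 1 ∧ HasNontangentialLimit φ.eval ω (c ω) := by
    filter_upwards [hφ] with ω hω using hc ω hω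
  have hα : ‖starRingEnd ℂ (α : ℂ)‖ = 1 := by rw [RCLike.norm_conj, Circle.norm_coe]
  have hαα : starRingEnd ℂ (α : ℂ) * α = 1 := by
    rw [mul_comm, Complex.mul_conj, Circle.normSq_coe, Complex.ofReal_one]
  set G : ℂ → ℂ := fun w => (1 + starRingEnd ℂ (α : ℂ) * w) / 2 with hG
  have hGc : Continuous G := by fun_prop
  have hGle : ∀ w, ‖w‖ ≤ 1 → ‖G w‖ ≤ 1 := by
    intro w hw
    have h := norm_add_le 1 (starRingEnd ℂ (α : ℂ) * w)
    rw [norm_mul, hα, norm_one] at h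
    rw [hG, norm_div, Complex.norm_ofNat, div_le_one two_pos]
    linarith
  have hmean : ∀ N : ℕ, ∫ ω, G (c ω) ^ N ∂circleLebesgue = (1 / 2) ^ N := by
    intro N
    have hd : DifferentiableOn ℂ (fun z => G (φ.eval z) ^ N) (Metric.ball 0 1) := by
      have := φ.differentiableOn_eval
      fun_prop
    have h1 : Tendsto (fun j => ∫ ω : Circle, G (φ.eval (HardySpace.radius j * ω)) ^ N
        ∂circleLebesgue) atTop (𝓝 (∫ ω, G (c ω) ^ N ∂circleLebesgue)) := by
      refine tendsto_integral_of_dominated_convergence (fun _ => 1)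
        (fun j => (continuous_comp_smul_circle hd.continuousOn (HardySpace.radius_nonneg j)
          (HardySpace.radius_lt_one j)).aestronglyMeasurable) (integrable_const _)
        (fun j => Eventually.of_forall fun ζ => ?_) ?_
      · rw [norm_pow]
        exact pow_le_one₀ (norm_nonneg _) (hGle _ (hb _ (norm_smul_circle_lt
          (HardySpace.radius_nonneg j) (HardySpace.radius_lt_one j) ζ)).le)
      · filter_upwards [hae] with ω hω
        exact ((hGc.tendsto _).comp hω.2.tendsto_radius).pow N
    have h2 : ∀ j, ∫ ω : Circle, G (φ.eval (HardySpace.radius j * ω)) ^ N ∂circleLebesgue =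
        (1 / 2) ^ N := by
      intro j
      rw [integral_circle_of_differentiableOn hd (HardySpace.radius_nonneg j)
        (HardySpace.radius_lt_one j), hφ0, hG]
      simp
    simp only [h2] at h1
    exact tendsto_nhds_unique h1 tendsto_const_nhds
  have hmeasc : AEStronglyMeasurable c circleLebesgue := by
    refine aestronglyMeasurable_of_tendsto_ae atTop
      (f := fun j (ω : Circle) => φ.eval (HardySpace.radius j * ω))
      (fun j => (continuous_comp_smul_circle φ.differentiableOn_eval.continuousOn
        (HardySpace.radius_nonneg j) (HardySpace.radius_lt_one j)).aestronglyMeasurable) ?_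
    filter_upwards [hae] with ω hω using hω.2.tendsto_radius
  set I : Circle → ℝ := fun ω => if c ω = α then 1 else 0 with hI
  have hmeas : ∀ N : ℕ, AEStronglyMeasurable (fun ω => G (c ω) ^ N) circleLebesgue := fun N =>
    (hGc.comp_aestronglyMeasurable hmeasc).pow N
  have hlim : ∀ᵐ ω ∂circleLebesgue, Tendsto (fun N => G (c ω) ^ N) atTop (𝓝 (I ω : ℂ)) := by
    filter_upwards [hae] with ω hω
    by_cases h : c ω = α
    · have : G (c ω) = 1 := by
        rw [hG, h]; simp only; rw [hαα]; norm_num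
      simp only [this, one_pow, hI, if_pos h, Complex.ofReal_one, tendsto_const_nhds]
    · have hlt : ‖G (c ω)‖ < 1 := by
        rw [hG, norm_div, Complex.norm_ofNat, div_lt_one two_pos]
        refine Complex.norm_one_add_lt_two (by rw [norm_mul, hα, hω.1, one_mul]) fun h1 => h ?_
        calc c ω = (starRingEnd ℂ (α : ℂ) * α) * c ω := by rw [hαα, one_mul]
          _ = α * (starRingEnd ℂ (α : ℂ) * c ω) := by ring
          _ = α := by rw [h1, mul_one]
      simpa [hI, h] using tendsto_pow_atTop_nhds_zero_of_norm_lt_one hlt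
  have hbound : ∀ N : ℕ, ∀ᵐ ω ∂circleLebesgue, ‖G (c ω) ^ N‖ ≤ 1 := by
    intro N
    filter_upwards [hae] with ω hω
    rw [norm_pow]
    exact pow_le_one₀ (norm_nonneg _) (hGle _ hω.1.le)
  have hI0 : ∫ ω, I ω ∂circleLebesgue = 0 := by
    have h1 := tendsto_integral_of_dominated_convergence (fun _ => (1 : ℝ)) hmeas
      (integrable_const _) hbound hlim
    simp only [hmean] at h1
    have h2 : Tendsto (fun N : ℕ => (1 / 2 : ℂ) ^ N) atTop (𝓝 0) :=
      tendsto_pow_atTop_nhds_zero_of_norm_lt_one (by norm_num)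
    have h3 := tendsto_nhds_unique h1 h2
    rw [integral_complex_ofReal] at h3
    exact_mod_cast h3
  have hImeas : AEStronglyMeasurable I circleLebesgue := by
    have h := aestronglyMeasurable_of_tendsto_ae atTop hmeas hlim
    simpa using Complex.continuous_re.comp_aestronglyMeasurable h
  have hIint : Integrable I circleLebesgue := by
    refine Integrable.of_bound hImeas 1 (Eventually.of_forall fun ω => ?_)
    by_cases h : c ω = α <;> simp [hI, h]
  have hInn : ∀ ω, 0 ≤ I ω := fun ω => by
    by_cases h : c ω = α <;> simp [hI, h]
  have hI1 := (integral_eq_zero_iff_of_nonneg hInn hIint).mp hI0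
  filter_upwards [hae, hI1] with ω hω hω1
  refine ⟨c ω, hω.1, fun h => ?_, hω.2⟩
  simp [hI, h] at hω1

/-! ### Poisson and Herglotz integrals; the moments of a Clark measure -/

section Moments

variable (μ : Measure Circle)

/-- The Poisson integral of a measure on the circle. -/
noncomputable def poissonIntegral (z : ℂ) : ℝ :=
  ∫ ζ : Circle, (1 - ‖z‖ ^ 2) / ‖(ζ : ℂ) - z‖ ^ 2 ∂μ

/-- The moment `∫ ζ ^ k dμ`, for an integer `k`. -/
noncomputable def circleMoment (k : ℤ) : ℂ := ∫ ζ : Circle, ((ζ ^ k : Circle) : ℂ) ∂μ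

variable {μ}

theorem norm_circle_sub_pos (ζ : Circle) {z : ℂ} (hz : ‖z‖ < 1) : 0 < ‖(ζ : ℂ) - z‖ := by
  have := norm_sub_norm_le (ζ : ℂ) z
  rw [Circle.norm_coe] at this
  linarith

theorem circle_sub_ne_zero (ζ : Circle) {z : ℂ} (hz : ‖z‖ < 1) : (ζ : ℂ) - z ≠ 0 :=
  norm_pos_iff.mp (norm_circle_sub_pos ζ hz)

theorem continuous_poissonKernel_circle {z : ℂ} (hz : ‖z‖ < 1) :
    Continuous fun ζ : Circle => (1 - ‖z‖ ^ 2) / ‖(ζ : ℂ) - z‖ ^ 2 :=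
  continuous_const.div (by fun_prop) fun ζ => pow_ne_zero 2 (norm_circle_sub_pos ζ hz).ne'

theorem Continuous.integrable_circle {E : Type*} [NormedAddCommGroup E] [IsFiniteMeasure μ]
    {f : Circle → E} (hf : Continuous f) : Integrable f μ :=
  hf.integrable_of_hasCompactSupport (HasCompactSupport.of_compactSpace _)

theorem re_add_div_sub (a b : ℂ) :
    ((a + b) / (a - b)).re = (‖a‖ ^ 2 - ‖b‖ ^ 2) / ‖a - b‖ ^ 2 := by
  have h := congrFun (poissonKernel_eq_re_herglotzRieszKernel (c := 0) (w := b)) a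
  simpa [poissonKernel, herglotzRieszKernel] using h.symm

theorem HasSum.of_eq {f g : ℕ → ℂ} {a b : ℂ} (h : HasSum f a) (hfg : ∀ n, g n = f n)
    (hab : b = a) : HasSum g b := by
  rw [funext hfg, hab]
  exact h

theorem hasSum_circleMoment [IsFiniteMeasure μ] {z : ℂ} (hz : ‖z‖ < 1) :
    HasSum (fun n : ℕ => circleMoment μ (-n) * z ^ n)
      (∫ ζ : Circle, (ζ : ℂ) / (ζ - z) ∂μ) := by
  set F : ℕ → Circle → ℂ := fun n ζ => ((ζ ^ (-n : ℤ) : Circle) : ℂ) * z ^ n with hF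
  have hFc : ∀ n, Continuous (F n) := fun n => by
    have h : Continuous fun ζ : Circle => (ζ : ℂ) := by fun_prop
    exact (h.comp (continuous_zpow _)).mul continuous_const
  have hFn : ∀ n ζ, ‖F n ζ‖ = ‖z‖ ^ n := fun n ζ => by
    rw [hF, norm_mul, Circle.norm_coe, one_mul, norm_pow]
  have h := hasSum_integral_of_summable_integral_norm (μ := μ) (F := F)
    (fun n => (hFc n).integrable_circle) (by
      simp only [hFn, integral_const, smul_eq_mul]
      exact (summable_geometric_of_lt_one (norm_nonneg z) hz).mul_left _)
  have h1 : ∀ ζ : Circle, ∑' n, F n ζ = (ζ : ℂ) / (ζ - z) := by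
    intro ζ
    have hζ : (ζ : ℂ) ≠ 0 := Circle.coe_ne_zero ζ
    have h2 : ∀ n, F n ζ = (z / ζ) ^ n := by
      intro n
      simp only [hF]
      rw [div_pow, Circle.coe_zpow, zpow_neg, zpow_natCast, mul_comm, div_eq_mul_inv]
    simp only [h2]
    rw [tsum_geometric_of_norm_lt_one (by rwa [norm_div, Circle.norm_coe, div_one]),
      one_sub_div hζ, inv_div]
  simp only [h1] at h
  refine h.of_eq (fun n => ?_) rfl
  exact (integral_mul_const _ _).symm

/-- A power series which vanishes on the unit disc has zero coefficients. -/
theorem eq_zero_of_hasSum_pow {a : ℕ → ℂ} (h : ∀ z : ℂ, ‖z‖ < 1 → HasSum (fun n => a n * z ^ n) 0)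
    (n : ℕ) : a n = 0 := by
  have h1 : HasFPowerSeriesAt (0 : ℂ → ℂ) (FormalMultilinearSeries.ofScalars ℂ a) 0 := by
    rw [hasFPowerSeriesAt_iff]
    filter_upwards [Metric.ball_mem_nhds (0 : ℂ) one_pos] with z hz
    rw [mem_ball_zero_iff] at hz
    refine (h z hz).of_eq (fun n => ?_) rfl
    rw [FormalMultilinearSeries.coeff_ofScalars, smul_eq_mul, mul_comm]
  rw [← FormalMultilinearSeries.coeff_ofScalars (𝕜 := ℂ) (p := a) (n := n), h1.eq_zero]
  rfl

end Moments

theorem HardySpace.coeff_zero_eq_zero {φ : HardySpace} (hφ0 : φ.eval 0 = 0) : φ 0 = 0 := by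
  rw [HardySpace.eval, tsum_eq_single 0 (fun n hn => by rw [zero_pow hn, mul_zero])] at hφ0
  simpa using hφ0

section Clark

variable {φ : HardySpace} {α : Circle} {μ : Measure Circle} [IsFiniteMeasure μ]

theorem IsClarkMeasure.measureReal_univ (hμ : IsClarkMeasure φ.eval α μ) (hφ0 : φ.eval 0 = 0) :
    μ.real Set.univ = 1 := by
  have h := hμ 0 (by simp)
  have hα : (α : ℂ) / α = 1 := div_self (Circle.coe_ne_zero α)
  rw [hφ0, add_zero, sub_zero, hα] at h
  simpa [Circle.norm_coe] using h.symm

theorem IsClarkMeasure.poissonIntegral_pos (hμ : IsClarkMeasure φ.eval α μ) (hφ0 : φ.eval 0 = 0)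
    {z : ℂ} (hz : ‖z‖ < 1) : 0 < poissonIntegral μ z := by
  have hpos : 0 < (1 - ‖z‖ ^ 2) / 4 := by
    have : ‖z‖ ^ 2 < 1 := pow_lt_one₀ (norm_nonneg z) hz two_ne_zero
    linarith
  refine lt_of_lt_of_le hpos ?_
  calc (1 - ‖z‖ ^ 2) / 4 = ∫ _ : Circle, (1 - ‖z‖ ^ 2) / 4 ∂μ := by
        rw [integral_const, hμ.measureReal_univ hφ0, one_smul]
    _ ≤ _ := by
        refine integral_mono (integrable_const _)
          (continuous_poissonKernel_circle hz).integrable_circle fun ζ => ?_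
        refine div_le_div_of_nonneg_left (by linarith) (pow_pos (norm_circle_sub_pos ζ hz) 2) ?_
        have := norm_sub_le (ζ : ℂ) z
        rw [Circle.norm_coe] at this
        nlinarith [norm_nonneg ((ζ : ℂ) - z)]

/-- The quotient defining a Clark measure has no pole in the disc: there it would take the junk
value zero, while the Poisson integral is positive. -/
theorem IsClarkMeasure.sub_ne_zero (hμ : IsClarkMeasure φ.eval α μ) (hφ0 : φ.eval 0 = 0)
    {z : ℂ} (hz : ‖z‖ < 1) : (α : ℂ) - φ.eval z ≠ 0 := by
  intro h
  have h1 := hμ.poissonIntegral_pos hφ0 hz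
  have h2 := hμ z hz
  rw [h, div_zero, Complex.zero_re] at h2
  exact h1.ne h2

theorem IsClarkMeasure.poissonIntegral_eq (hμ : IsClarkMeasure φ.eval α μ)
    {z : ℂ} (hz : ‖z‖ < 1) :
    poissonIntegral μ z = (1 - ‖φ.eval z‖ ^ 2) / ‖(α : ℂ) - φ.eval z‖ ^ 2 := by
  rw [poissonIntegral, ← hμ z hz, re_add_div_sub, Circle.norm_coe, one_pow]

theorem IsClarkMeasure.norm_eval_lt_one (hμ : IsClarkMeasure φ.eval α μ) (hφ0 : φ.eval 0 = 0)
    {z : ℂ} (hz : ‖z‖ < 1) : ‖φ.eval z‖ < 1 := by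
  have h1 := hμ.poissonIntegral_pos hφ0 hz
  rw [hμ.poissonIntegral_eq hz] at h1
  -- `(1 - ‖φ‖²) / ‖α - φ‖²` is positive, hence so is its numerator.
  have h2 := (div_pos_iff_of_pos_right
    (pow_pos (norm_pos_iff.mpr (hμ.sub_ne_zero hφ0 hz)) 2)).mp h1
  nlinarith [norm_nonneg (φ.eval z)]

/-- The Cauchy transform of the Clark measure is `α / (α - φ)`: by the Clark identity the two
holomorphic functions `(α + φ) / (α - φ)` and `∫ (ζ + z) / (ζ - z) dμ` have the same real part,
and they agree at the origin. -/
theorem IsClarkMeasure.integral_cauchyKernel (hμ : IsClarkMeasure φ.eval α μ)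
    (hφ0 : φ.eval 0 = 0) {z : ℂ} (hz : ‖z‖ < 1) :
    ∫ ζ : Circle, (ζ : ℂ) / (ζ - z) ∂μ = α / (α - φ.eval z) := by
  set K : ℂ → ℂ := fun z => ∫ ζ : Circle, (ζ : ℂ) / (ζ - z) ∂μ with hK
  have hcont : ∀ {z : ℂ}, ‖z‖ < 1 → Continuous fun ζ : Circle => (ζ : ℂ) / (ζ - z) :=
    fun {z} hz => Continuous.div (by fun_prop) (by fun_prop) fun ζ => circle_sub_ne_zero ζ hz
  have hKd : DifferentiableOn ℂ K (Metric.ball 0 1) := by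
    have h : DifferentiableOn ℂ (fun z => ∑' n : ℕ, circleMoment μ (-n) * z ^ n)
        (Metric.ball 0 1) := by
      refine differentiableOn_tsum_pow (C := 1) fun n => ?_
      refine (norm_integral_le_of_norm_le_const (C := 1)
        (Eventually.of_forall fun ζ => (Circle.norm_coe _).le)).trans ?_
      rw [hμ.measureReal_univ hφ0, one_mul]
    refine h.congr fun z hz => ?_
    rw [mem_ball_zero_iff] at hz
    exact (hasSum_circleMoment hz).tsum_eq.symm
  set D : ℂ → ℂ := fun z => (α + φ.eval z) / (α - φ.eval z) - (2 * K z - 1) with hD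
  have hDd : DifferentiableOn ℂ D (Metric.ball 0 1) := by
    have h1 := φ.differentiableOn_eval
    have h2 : ∀ z ∈ Metric.ball (0 : ℂ) 1, (α : ℂ) - φ.eval z ≠ 0 := fun z hz =>
      hμ.sub_ne_zero hφ0 (mem_ball_zero_iff.mp hz)
    refine DifferentiableOn.sub (DifferentiableOn.div (by fun_prop) (by fun_prop) h2) (by fun_prop)
  have hDre : ∀ z ∈ Metric.ball (0 : ℂ) 1, (D z).re = 0 := by
    intro z hz
    rw [mem_ball_zero_iff] at hz
    have h1 : 2 * K z - 1 = ∫ ζ : Circle, ((ζ : ℂ) + z) / (ζ - z) ∂μ := by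
      have h2 : ∀ ζ : Circle, ((ζ : ℂ) + z) / (ζ - z) = 2 * ((ζ : ℂ) / (ζ - z)) - 1 := by
        intro ζ
        have := circle_sub_ne_zero ζ hz
        field_simp
        ring
      simp only [h2]
      rw [integral_sub ((hcont hz).integrable_circle.const_mul 2) (integrable_const _),
        integral_const_mul, integral_const, hμ.measureReal_univ hφ0, one_smul]
    have h3 : (∫ ζ : Circle, ((ζ : ℂ) + z) / (ζ - z) ∂μ).re =
        ∫ ζ : Circle, (((ζ : ℂ) + z) / (ζ - z)).re ∂μ := by
      have hi : Integrable (fun ζ : Circle => ((ζ : ℂ) + z) / (ζ - z)) μ :=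
        Continuous.integrable_circle (Continuous.div (by fun_prop) (by fun_prop)
          fun ζ => circle_sub_ne_zero ζ hz)
      exact (Complex.reCLM.integral_comp_comm hi).symm
    rw [hD, Complex.sub_re, h1, h3, hμ z hz, sub_eq_zero]
    refine integral_congr_ae (Eventually.of_forall fun ζ => ?_)
    simp only
    rw [re_add_div_sub, Circle.norm_coe, one_pow]
  obtain ⟨c, hc⟩ := (hDd.analyticOnNhd Metric.isOpen_ball).eq_const_of_re_eq_const hDre
    Metric.isOpen_ball (Metric.isConnected_ball one_pos)
  have hD0 : D 0 = 0 := by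
    have hα : (α : ℂ) / α = 1 := div_self (Circle.coe_ne_zero α)
    have hζ : ∀ ζ : Circle, (ζ : ℂ) / ζ = 1 := fun ζ => div_self (Circle.coe_ne_zero ζ)
    rw [hD]
    simp only [hφ0, hK, add_zero, sub_zero, hα, hζ, integral_const, hμ.measureReal_univ hφ0,
      one_smul]
    norm_num
  have hDz : D z = 0 := by
    rw [hc z (mem_ball_zero_iff.mpr hz), ← hc 0 (Metric.mem_ball_self one_pos), hD0]
  have h1 := hμ.sub_ne_zero hφ0 hz
  have h2 : 2 * K z = (α + φ.eval z) / (α - φ.eval z) + 1 := by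
    rw [hD] at hDz
    linear_combination -hDz
  have h3 : (α + φ.eval z) / (α - φ.eval z) + 1 = 2 * (α / (α - φ.eval z)) := by
    field_simp
    ring
  rw [h3] at h2
  exact mul_left_cancel₀ two_ne_zero h2

/-- The coefficients of `conj α φ` and the moments of the Clark measure: the comparison of the
coefficients in `F = 1 + conj α φ F`, where `F` is the Cauchy transform of `μ`. -/
theorem IsClarkMeasure.sum_mul_circleMoment (hμ : IsClarkMeasure φ.eval α μ)
    (hφ0 : φ.eval 0 = 0) (n : ℕ) :
    ∑ k ∈ Finset.range (n + 1), starRingEnd ℂ (α : ℂ) * φ (k + 1) * circleMoment μ (k - n) =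
      circleMoment μ (-(n + 1)) := by
  have hα : starRingEnd ℂ (α : ℂ) * α = 1 := by
    rw [mul_comm, Complex.mul_conj, Circle.normSq_coe, Complex.ofReal_one]
  have hφ00 := HardySpace.coeff_zero_eq_zero hφ0
  set b : ℕ → ℂ := fun k => starRingEnd ℂ (α : ℂ) * φ k with hb
  set m : ℕ → ℂ := fun k => circleMoment μ (-k) with hm
  set a : ℕ → ℂ := fun n => ∑ k ∈ Finset.range (n + 1), b k * m (n - k) - m n +
    if n = 0 then 1 else 0 with ha
  have ha0 : ∀ n, a n = 0 := by
    refine eq_zero_of_hasSum_pow fun z hz => ?_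
    have hbs : Summable fun k => ‖b k * z ^ k‖ := by
      simp only [hb, mul_assoc]
      exact ((φ.summable_eval hz).mul_left _).norm
    have hms := hasSum_circleMoment (μ := μ) hz
    have hb1 : HasSum (fun k => b k * z ^ k) (starRingEnd ℂ (α : ℂ) * φ.eval z) := by
      simp only [hb, mul_assoc]
      exact (φ.summable_eval hz).hasSum.mul_left _
    have hmn : Summable fun k => ‖m k * z ^ k‖ := hms.summable.norm
    have h1 := tsum_mul_tsum_eq_tsum_sum_range_of_summable_norm hbs hmn
    have h2 := (summable_norm_sum_mul_range_of_summable_norm hbs hmn).of_norm.hasSum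
    rw [← h1, hb1.tsum_eq, hms.tsum_eq, hμ.integral_cauchyKernel hφ0 hz] at h2
    rw [hμ.integral_cauchyKernel hφ0 hz] at hms
    have h3 := (h2.sub hms).add (hasSum_ite_eq (0 : ℕ) (1 : ℂ))
    refine h3.of_eq (fun n => ?_) ?_
    · simp only [ha, add_mul, sub_mul, Finset.sum_mul, hm]
      congr 1
      · congr 1
        refine Finset.sum_congr rfl fun k hk => ?_
        have : z ^ n = z ^ k * z ^ (n - k) := by
          rw [← pow_add, Nat.add_sub_cancel' (Nat.lt_succ_iff.mp (Finset.mem_range.mp hk))]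
        rw [this]
        ring
      · by_cases h : n = 0 <;> simp [h]
    · have := hμ.sub_ne_zero hφ0 hz
      field_simp
      linear_combination -φ.eval z * hα
  -- The term `k = 0` of the convolution vanishes, as `φ 0 = 0`.
  have h := ha0 (n + 1)
  simp only [ha, hb, Finset.sum_range_succ' _ (n + 1), hφ00, mul_zero, zero_mul, add_zero,
    Nat.succ_ne_zero, if_false, Nat.add_sub_add_right] at h
  rw [sub_eq_zero] at h
  simp only [hm, Nat.cast_add, Nat.cast_one] at h
  rw [← h]
  refine Finset.sum_congr rfl fun k hk => ?_
  congr 2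
  have := Finset.mem_range.mp hk
  omega

end Clark

/-! ### The model space projection of the monomials -/

namespace HardySpace

theorem eval_add (f g : HardySpace) {z : ℂ} (hz : ‖z‖ < 1) :
    (f + g).eval z = f.eval z + g.eval z := by
  unfold eval
  rw [← (f.summable_eval hz).tsum_add (g.summable_eval hz)]
  simp [add_mul]

theorem eval_smul (c : ℂ) (f : HardySpace) (z : ℂ) : (c • f).eval z = c * f.eval z := by
  unfold eval
  rw [← tsum_mul_left]
  simp [mul_assoc]

theorem eval_sub (f g : HardySpace) {z : ℂ} (hz : ‖z‖ < 1) :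
    (f - g).eval z = f.eval z - g.eval z := by
  rw [sub_eq_add_neg, ← neg_one_smul ℂ g, eval_add _ _ hz, eval_smul]
  ring

theorem eval_sum {ι : Type*} (s : Finset ι) (f : ι → HardySpace) {z : ℂ} (hz : ‖z‖ < 1) :
    (∑ i ∈ s, f i).eval z = ∑ i ∈ s, (f i).eval z := by
  classical
  induction s using Finset.induction_on with
  | empty => simp [eval]
  | insert i s hi ih => rw [Finset.sum_insert hi, Finset.sum_insert hi, eval_add _ _ hz, ih]

theorem eval_monomial (n : ℕ) (z : ℂ) : (monomial n).eval z = z ^ n := by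
  rw [eval, tsum_eq_single n fun k hk => ?_]
  · simp [monomial]
  · simp [monomial, hk]

theorem norm_monomial (n : ℕ) : ‖monomial n‖ = 1 := by
  rw [monomial, lp.norm_single (by norm_num), norm_one]

theorem inner_monomial (f : HardySpace) (n : ℕ) :
    inner ℂ f (monomial n) = starRingEnd ℂ (f n) := by
  rw [monomial, lp.inner_single_right]
  simp

theorem hasSum_shift_norm_sq (j : ℕ) (f : HardySpace) :
    HasSum (fun n => ‖if j ≤ n then f (n - j) else 0‖ ^ 2) (‖f‖ ^ 2) := by
  rw [← hasSum_nat_add_iff' j]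
  have h1 : ∑ i ∈ Finset.range j, ‖if j ≤ i then f (i - j) else 0‖ ^ 2 = 0 :=
    Finset.sum_eq_zero fun i hi => by
      rw [if_neg (not_le.mpr (Finset.mem_range.mp hi))]; simp
  rw [h1, sub_zero]
  simpa using lp.hasSum_norm_sq f

/-- The product `z ^ j f`. -/
noncomputable def shift (j : ℕ) (f : HardySpace) : HardySpace :=
  ⟨fun n => if j ≤ n then f (n - j) else 0, memℓp_gen (by
    simpa using (hasSum_shift_norm_sq j f).summable)⟩

theorem shift_apply (j : ℕ) (f : HardySpace) (n : ℕ) :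
    shift j f n = if j ≤ n then f (n - j) else 0 := rfl

theorem norm_shift (j : ℕ) (f : HardySpace) : ‖shift j f‖ = ‖f‖ := by
  have h := (lp.hasSum_norm_sq (shift j f)).unique (hasSum_shift_norm_sq j f)
  exact (sq_eq_sq₀ (norm_nonneg _) (norm_nonneg _)).mp h

theorem eval_shift (j : ℕ) (f : HardySpace) {z : ℂ} (hz : ‖z‖ < 1) :
    (shift j f).eval z = z ^ j * f.eval z := by
  rw [eval, ← ((shift j f).summable_eval hz).sum_add_tsum_nat_add j]
  have h1 : ∑ i ∈ Finset.range j, shift j f i * z ^ i = 0 :=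
    Finset.sum_eq_zero fun i hi => by
      rw [shift_apply, if_neg (not_le.mpr (Finset.mem_range.mp hi)), zero_mul]
  rw [h1, zero_add, eval, ← tsum_mul_left]
  refine tsum_congr fun n => ?_
  rw [shift_apply, if_pos (Nat.le_add_left j n), Nat.add_sub_cancel, pow_add]
  ring

/-- Multiplication by an inner function is a contraction which preserves the norm of the monomials,
so it preserves the inner products with them. -/
theorem inner_shift_of_eval_eq_mul {φ : HardySpace} (hb : ∀ z, ‖z‖ < 1 → ‖φ.eval z‖ ≤ 1)
    (hφ1 : ‖φ‖ = 1) {f g : HardySpace} (h : ∀ z, ‖z‖ < 1 → f.eval z = φ.eval z * g.eval z)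
    (j : ℕ) : inner ℂ f (shift j φ) = starRingEnd ℂ (g j) := by
  rw [← inner_monomial]
  refine inner_eq_of_norm_add_smul_le (fun t => norm_le_of_eval_eq_mul hb fun z hz => ?_) ?_
  · rw [eval_add _ _ hz, eval_add _ _ hz, eval_smul, eval_smul, eval_shift _ _ hz, eval_monomial,
      h z hz]
    ring
  · rw [norm_shift, hφ1, norm_monomial]

theorem coeff_of_eval_eq_mul {φ f g : HardySpace}
    (h : ∀ z, ‖z‖ < 1 → f.eval z = φ.eval z * g.eval z) (n : ℕ) :
    f n = ∑ k ∈ Finset.range (n + 1), φ k * g (n - k) := by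
  rw [← sub_eq_zero]
  refine eq_zero_of_hasSum_pow
    (a := fun n => f n - ∑ k ∈ Finset.range (n + 1), φ k * g (n - k)) (fun z hz => ?_) n
  have hφs := (φ.summable_eval hz).norm
  have hgs := (g.summable_eval hz).norm
  have h1 := tsum_mul_tsum_eq_tsum_sum_range_of_summable_norm hφs hgs
  have h2 := (summable_norm_sum_mul_range_of_summable_norm hφs hgs).of_norm.hasSum
  rw [← h1] at h2
  refine ((f.summable_eval hz).hasSum.sub h2).of_eq (fun n => ?_) ?_
  · rw [sub_mul, Finset.sum_mul]
    congr 1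
    refine Finset.sum_congr rfl fun k hk => ?_
    have : z ^ n = z ^ k * z ^ (n - k) := by
      rw [← pow_add, Nat.add_sub_cancel' (Nat.lt_succ_iff.mp (Finset.mem_range.mp hk))]
    rw [this]
    ring
  · exact (sub_eq_zero.mpr (h z hz)).symm

end HardySpace

open HardySpace in
/-- `P_φ zⁿ = zⁿ - φ ∑_{k ≤ n} conj (aₖ) z^{n-k}`, where `φ = ∑ aₖ zᵏ`. -/
theorem modelProjection_monomial {φ : HardySpace} (hb : ∀ z, ‖z‖ < 1 → ‖φ.eval z‖ ≤ 1)
    (hφ1 : ‖φ‖ = 1) (n : ℕ) :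
    modelProjection φ (monomial n) = monomial n -
      ∑ k ∈ Finset.range (n + 1), starRingEnd ℂ (φ k) • shift (n - k) φ := by
  refine Submodule.eq_starProjection_of_mem_orthogonal ?_ ?_
  · rw [Submodule.mem_orthogonal]
    rintro f ⟨g, hg⟩
    rw [inner_sub_right, inner_monomial, inner_sum, coeff_of_eval_eq_mul hg, map_sum, sub_eq_zero]
    refine Finset.sum_congr rfl fun k _ => ?_
    rw [inner_smul_right, inner_shift_of_eval_eq_mul hb hφ1 hg, map_mul]
  · rw [sub_sub_cancel]
    refine Submodule.le_orthogonal_orthogonal _ ?_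
    refine Submodule.sum_mem _ fun k _ => Submodule.smul_mem _ _ ?_
    refine ⟨monomial (n - k), fun z hz => ?_⟩
    rw [eval_shift _ _ hz, eval_monomial, mul_comm]

open HardySpace in
theorem eval_modelProjection_monomial {φ : HardySpace} (hb : ∀ z, ‖z‖ < 1 → ‖φ.eval z‖ ≤ 1)
    (hφ1 : ‖φ‖ = 1) (n : ℕ) {z : ℂ} (hz : ‖z‖ < 1) :
    (modelProjection φ (monomial n)).eval z =
      z ^ n - φ.eval z * ∑ k ∈ Finset.range (n + 1), starRingEnd ℂ (φ k) * z ^ (n - k) := by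
  rw [modelProjection_monomial hb hφ1, eval_sub _ _ hz, eval_monomial, eval_sum _ _ hz,
    Finset.mul_sum]
  congr 1
  refine Finset.sum_congr rfl fun k _ => ?_
  rw [eval_smul, eval_shift _ _ hz]
  ring

/-! ### Singularity of the Clark measure and its boundary behaviour -/

theorem norm_circle_exp_sub_le (x y : ℝ) :
    ‖(Circle.exp x : ℂ) - Circle.exp y‖ ≤ |x - y| := by
  have h1 : (Circle.exp x : ℂ) - Circle.exp y =
      Circle.exp y * (Complex.exp (Complex.I * ((x - y : ℝ) : ℂ)) - 1) := by
    rw [mul_sub, mul_one, Circle.coe_exp, Circle.coe_exp, ← Complex.exp_add]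
    congr 2
    push_cast
    ring
  rw [h1, norm_mul, Circle.norm_coe, one_mul]
  exact Real.norm_exp_I_mul_ofReal_sub_one_le

/-- The trace of a disc of radius `t ≤ 1` centred on the circle has Lebesgue measure at least
`t / 2π`: it contains an arc of length `t` on one side of its centre. -/
theorem ofReal_le_circleLebesgue_closedBall (ω : Circle) {t : ℝ} (ht1 : t ≤ 1) :
    ENNReal.ofReal t ≤ ENNReal.ofReal (2 * Real.pi) *
      circleLebesgue {ζ : Circle | (ζ : ℂ) ∈ Metric.closedBall (ω : ℂ) t} := by
  have hπ := Real.pi_gt_three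
  obtain ⟨θ₀, h0, h2π, hω⟩ : ∃ θ₀ : ℝ, 0 < θ₀ ∧ θ₀ ≤ 2 * Real.pi ∧ Circle.exp θ₀ = ω := by
    have h1 := Complex.neg_pi_lt_arg (ω : ℂ)
    have h2 := Complex.arg_le_pi (ω : ℂ)
    rcases lt_or_ge 0 (Complex.arg ω) with h | h
    · exact ⟨Complex.arg ω, h, by linarith, Circle.exp_arg ω⟩
    · refine ⟨Complex.arg ω + 2 * Real.pi, by linarith, by linarith, ?_⟩
      rw [Circle.exp_add_two_pi, Circle.exp_arg]
  have hmeas : MeasurableSet {ζ : Circle | (ζ : ℂ) ∈ Metric.closedBall (ω : ℂ) t} :=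
    (Metric.isClosed_closedBall.preimage (by fun_prop : Continuous fun ζ : Circle =>
      (ζ : ℂ))).measurableSet
  have hexp : Measurable fun θ : ℝ => Circle.exp θ := by fun_prop
  rw [circleLebesgue, Measure.smul_apply, Measure.map_apply hexp hmeas, smul_eq_mul, ← mul_assoc,
    ENNReal.mul_inv_cancel (by simp [Real.pi_pos]) ENNReal.ofReal_ne_top, one_mul,
    Measure.restrict_apply (hexp hmeas)]
  have key : ∀ a b : ℝ, b - a = t → 0 ≤ a → b ≤ 2 * Real.pi →
      (∀ θ ∈ Set.Ioc a b, |θ - θ₀| ≤ t) → ENNReal.ofReal t ≤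
      volume ((fun θ : ℝ => Circle.exp θ) ⁻¹' {ζ : Circle | (ζ : ℂ) ∈
        Metric.closedBall (ω : ℂ) t} ∩ Set.Ioc 0 (2 * Real.pi)) := by
    intro a b hab ha hb h
    rw [← hab, ← Real.volume_Ioc]
    refine measure_mono fun θ hθ => ⟨?_, lt_of_le_of_lt ha hθ.1, hθ.2.trans hb⟩
    simp only [Set.mem_preimage, Set.mem_ofPred_eq]
    rw [mem_closedBall_iff_norm, ← hω, hab]
    exact (norm_circle_exp_sub_le θ θ₀).trans (h θ hθ)
  rcases le_or_gt 1 θ₀ with h | h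
  · refine key (θ₀ - t) θ₀ (by ring) (by linarith) h2π fun θ hθ => ?_
    rw [abs_le]
    exact ⟨by linarith [hθ.1], by linarith [hθ.1, hθ.2]⟩
  · refine key θ₀ (θ₀ + t) (by ring) h0.le (by linarith) fun θ hθ => ?_
    rw [abs_le]
    exact ⟨by linarith [hθ.1, hθ.2], by linarith [hθ.2]⟩

/-- In a Stolz region at `ω` the Poisson integral dominates the average of `μ` over the disc of
radius `1 - |z|` about `ω`. -/
theorem measure_closedBall_le_poissonIntegral {μ : Measure Circle} [IsFiniteMeasure μ] {C : ℝ}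
    {ω : Circle} {z : ℂ} (hz : z ∈ approachRegion C ω) :
    μ {ζ : Circle | (ζ : ℂ) ∈ Metric.closedBall (ω : ℂ) (1 - ‖z‖)} ≤
      ENNReal.ofReal ((C + 1) ^ 2 * (1 - ‖z‖) * poissonIntegral μ z) := by
  obtain ⟨hz1, hzC⟩ := hz
  set t := 1 - ‖z‖ with ht
  have ht0 : 0 < t := by linarith
  have hC : 0 < C := by
    by_contra hC
    nlinarith [norm_nonneg (z - (ω : ℂ))]
  set S := {ζ : Circle | (ζ : ℂ) ∈ Metric.closedBall (ω : ℂ) t} with hS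
  have hmeas : MeasurableSet S :=
    (Metric.isClosed_closedBall.preimage (by fun_prop : Continuous fun ζ : Circle =>
      (ζ : ℂ))).measurableSet
  set K : ℝ := ((C + 1) ^ 2 * t)⁻¹ with hK
  have hK0 : 0 < (C + 1) ^ 2 * t := by positivity
  have h1 : μ.real S * K ≤ poissonIntegral μ z := by
    calc μ.real S * K = ∫ ζ, S.indicator (fun _ => K) ζ ∂μ := by
          rw [integral_indicator_const _ hmeas, smul_eq_mul]
      _ ≤ _ := by
          refine integral_mono ((integrable_const K).indicator hmeas)
            (continuous_poissonKernel_circle hz1).integrable_circle fun ζ => ?_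
          have hpos := norm_circle_sub_pos ζ hz1
          have hnum : t ≤ 1 - ‖z‖ ^ 2 := by nlinarith [norm_nonneg z]
          by_cases hζ : ζ ∈ S
          · rw [Set.indicator_of_mem hζ]
            have hζ' : ‖(ζ : ℂ) - ω‖ ≤ t := mem_closedBall_iff_norm.mp hζ
            have hle : ‖(ζ : ℂ) - z‖ ≤ (C + 1) * t := by
              have := norm_sub_le_norm_sub_add_norm_sub (ζ : ℂ) ω z
              rw [norm_sub_rev (ω : ℂ) z] at this
              linarith
            rw [hK, inv_eq_one_div, div_le_div_iff₀ hK0 (pow_pos hpos 2), one_mul]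
            calc ‖(ζ : ℂ) - z‖ ^ 2 ≤ ((C + 1) * t) ^ 2 :=
                  pow_le_pow_left₀ (norm_nonneg _) hle 2
              _ = t * ((C + 1) ^ 2 * t) := by ring
              _ ≤ _ := by gcongr
          · rw [Set.indicator_of_notMem hζ]
            exact div_nonneg (by linarith) (sq_nonneg _)
  rw [hK, ← div_eq_mul_inv, div_le_iff₀ hK0] at h1
  rw [← ofReal_measureReal]
  exact ENNReal.ofReal_le_ofReal (by linarith)

theorem measurable_circle_coe : Measurable fun ζ : Circle => (ζ : ℂ) :=
  (by fun_prop : Continuous fun ζ : Circle => (ζ : ℂ)).measurable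

section Clark

variable {φ : HardySpace} {α : Circle} {μ : Measure Circle} [IsFiniteMeasure μ]

/-- The Clark measure of an inner function is singular. Its Poisson integral
`(1 - |φ|²) / |α - φ|²` tends to zero along almost every radius, and it dominates the averages of
the measure, whose limits are the values of the Radon-Nikodym derivative. -/
theorem IsClarkMeasure.mutuallySingular (hφ : IsInnerFunction φ) (hφ0 : φ.eval 0 = 0)
    (hμ : IsClarkMeasure φ.eval α μ) :
    μ.map (fun ζ : Circle => (ζ : ℂ)) ⟂ₘ circleLebesgue.map (fun ζ : Circle => (ζ : ℂ)) := by
  rw [← Measure.rnDeriv_eq_zero]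
  have hB := Besicovitch.ae_tendsto_rnDeriv (μ.map (fun ζ : Circle => (ζ : ℂ)))
    (circleLebesgue.map (fun ζ : Circle => (ζ : ℂ)))
  have hset : MeasurableSet {x : ℂ | (μ.map (fun ζ : Circle => (ζ : ℂ))).rnDeriv
      (circleLebesgue.map (fun ζ : Circle => (ζ : ℂ))) x = (0 : ℂ → ENNReal) x} :=
    measurableSet_eq_fun (Measure.measurable_rnDeriv _ _) measurable_zero
  refine (ae_map_iff measurable_circle_coe.aemeasurable hset).mpr ?_
  filter_upwards [ae_of_ae_map measurable_circle_coe.aemeasurable hB,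
    hφ.ae_ne (fun z hz => hμ.norm_eval_lt_one hφ0 hz) hφ0 α] with ω hω hc
  obtain ⟨c, hc1, hcα, hlim⟩ := hc
  have ht : Tendsto (fun j => 1 - HardySpace.radius j) atTop (𝓝[>] 0) := by
    refine tendsto_nhdsWithin_iff.mpr ⟨?_, Eventually.of_forall fun j =>
      sub_pos.mpr (HardySpace.radius_lt_one j)⟩
    simpa using tendsto_const_nhds (x := (1 : ℝ)).sub HardySpace.tendsto_radius
  have h1 := hω.comp ht
  -- The numerator tends to `1 - |c|² = 0` and the denominator to `|α - c|² ≠ 0`.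
  have hP : Tendsto (fun j => poissonIntegral μ (HardySpace.radius j * ω)) atTop (𝓝 0) := by
    have h2 := hlim.tendsto_radius
    have h3 : Tendsto (fun j => (1 - ‖φ.eval (HardySpace.radius j * ω)‖ ^ 2) /
        ‖(α : ℂ) - φ.eval (HardySpace.radius j * ω)‖ ^ 2) atTop
        (𝓝 ((1 - ‖c‖ ^ 2) / ‖(α : ℂ) - c‖ ^ 2)) := by
      refine (tendsto_const_nhds.sub (h2.norm.pow 2)).div
        ((tendsto_const_nhds.sub h2).norm.pow 2) ?_
      exact pow_ne_zero 2 (norm_ne_zero_iff.mpr (_root_.sub_ne_zero.mpr hcα.symm))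
    rw [hc1, one_pow, sub_self, zero_div] at h3
    refine h3.congr fun j => ?_
    rw [hμ.poissonIntegral_eq (norm_smul_circle_lt (HardySpace.radius_nonneg j)
      (HardySpace.radius_lt_one j) ω)]
  have hE : Tendsto (fun j => ENNReal.ofReal ((2 + 1) ^ 2 *
      poissonIntegral μ (HardySpace.radius j * ω)) * ENNReal.ofReal (2 * Real.pi)) atTop
      (𝓝 0) := by
    have h2 := ENNReal.tendsto_ofReal (hP.const_mul ((2 + 1) ^ 2))
    rw [mul_zero, ENNReal.ofReal_zero] at h2
    have h3 := ENNReal.Tendsto.mul_const h2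
      (Or.inr (ENNReal.ofReal_ne_top (r := 2 * Real.pi)))
    rwa [zero_mul] at h3
  refine tendsto_nhds_unique h1
    (tendsto_of_tendsto_of_tendsto_of_le_of_le tendsto_const_nhds hE (fun _ => zero_le)
      fun j => ?_)
  have hr0 := HardySpace.radius_nonneg j
  have hr1 := HardySpace.radius_lt_one j
  have hnorm : ‖(HardySpace.radius j : ℂ) * ω‖ = HardySpace.radius j := by
    rw [norm_mul, Circle.norm_coe, mul_one, Complex.norm_real, Real.norm_of_nonneg hr0]
  have hreg : (HardySpace.radius j : ℂ) * ω ∈ approachRegion 2 ω :=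
    radius_mul_mem_approachRegion ω j
  have h2 := measure_closedBall_le_poissonIntegral (μ := μ) hreg
  have h3 := ofReal_le_circleLebesgue_closedBall ω (t := 1 - HardySpace.radius j) (by linarith)
  rw [hnorm] at h2
  refine ENNReal.div_le_of_le_mul ?_
  rw [Measure.map_apply measurable_circle_coe Metric.isClosed_closedBall.measurableSet,
    Measure.map_apply measurable_circle_coe Metric.isClosed_closedBall.measurableSet]
  refine h2.trans ?_
  have hPnn := (hμ.poissonIntegral_pos hφ0 (norm_smul_circle_lt hr0 hr1 ω)).le
  rw [mul_right_comm, ENNReal.ofReal_mul (by positivity), mul_assoc]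
  exact mul_le_mul_right h3 _

/-- The inner function has the non-tangential limit `α` at almost every point for its Clark
measure. Since the measure is singular, its averages tend to infinity almost everywhere for the
measure itself, hence so does the Poisson integral, which is at most `1 / |α - φ|²`. -/
theorem IsClarkMeasure.ae_hasNontangentialLimit (hφ : IsInnerFunction φ) (hφ0 : φ.eval 0 = 0)
    (hμ : IsClarkMeasure φ.eval α μ) :
    ∀ᵐ ω ∂μ, HasNontangentialLimit φ.eval ω α := by
  have hsing := (hμ.mutuallySingular hφ hφ0).symm.rnDeriv_ae_eq_zero
  have hB := Besicovitch.ae_tendsto_rnDeriv (circleLebesgue.map (fun ζ : Circle => (ζ : ℂ)))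
    (μ.map (fun ζ : Circle => (ζ : ℂ)))
  filter_upwards [ae_of_ae_map measurable_circle_coe.aemeasurable hB,
    ae_of_ae_map measurable_circle_coe.aemeasurable hsing] with ω hω hω0 C
  rw [hω0, Pi.zero_apply] at hω
  have hmem : ∀ᶠ z in 𝓝[approachRegion C ω] (ω : ℂ), z ∈ approachRegion C ω :=
    eventually_mem_nhdsWithin
  have ht : Tendsto (fun z : ℂ => 1 - ‖z‖) (𝓝[approachRegion C ω] (ω : ℂ)) (𝓝[>] 0) := by
    refine tendsto_nhdsWithin_iff.mpr ⟨?_, hmem.mono fun z hz => sub_pos.mpr hz.1⟩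
    have h : Tendsto (fun z : ℂ => 1 - ‖z‖) (𝓝 (ω : ℂ)) (𝓝 (1 - ‖(ω : ℂ)‖)) :=
      Continuous.tendsto (by fun_prop) _
    rw [Circle.norm_coe, sub_self] at h
    exact h.mono_left nhdsWithin_le_nhds
  have h1 := hω.comp ht
  have h2 := ENNReal.Tendsto.const_mul (a := ENNReal.ofReal ((C + 1) ^ 2) *
    ENNReal.ofReal (2 * Real.pi)) h1
    (Or.inr (ENNReal.mul_ne_top ENNReal.ofReal_ne_top ENNReal.ofReal_ne_top))
  rw [mul_zero] at h2
  have h3 : Tendsto (fun z => ENNReal.ofReal (‖(α : ℂ) - φ.eval z‖ ^ 2))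
      (𝓝[approachRegion C ω] (ω : ℂ)) (𝓝 0) := by
    refine tendsto_of_tendsto_of_tendsto_of_le_of_le' tendsto_const_nhds h2
      (Eventually.of_forall fun _ => zero_le) ?_
    filter_upwards [hmem] with z hz
    have hz1 := hz.1
    have ht1 : 1 - ‖z‖ ≤ 1 := by linarith [norm_nonneg z]
    have hL := ofReal_le_circleLebesgue_closedBall ω ht1
    have hM := measure_closedBall_le_poissonIntegral (μ := μ) hz
    simp only [Function.comp_apply]
    rw [Measure.map_apply measurable_circle_coe Metric.isClosed_closedBall.measurableSet,
      Measure.map_apply measurable_circle_coe Metric.isClosed_closedBall.measurableSet,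
      ← mul_div_assoc]
    -- Were `μ` zero on the disc, the quotient would be `∞`, since the Lebesgue measure is positive.
    have hLpos : circleLebesgue {ζ : Circle | (ζ : ℂ) ∈ Metric.closedBall (ω : ℂ) (1 - ‖z‖)} ≠ 0 :=
      fun h0 => by
        rw [h0, mul_zero, nonpos_iff_eq_zero, ENNReal.ofReal_eq_zero] at hL
        linarith
    refine (ENNReal.le_div_iff_mul_le (Or.inr ?_) (Or.inl (measure_ne_top _ _))).mpr ?_
    · refine mul_ne_zero (mul_ne_zero ?_ (by simp [Real.pi_pos])) hLpos
      have hC : 0 < C := by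
        by_contra hC
        have := hz.2
        nlinarith [norm_nonneg (z - (ω : ℂ))]
      exact (ENNReal.ofReal_pos.mpr (by positivity)).ne'
    · have hne := norm_pos_iff.mpr (hμ.sub_ne_zero hφ0 hz1)
      have hPα : ‖(α : ℂ) - φ.eval z‖ ^ 2 * poissonIntegral μ z ≤ 1 := by
        rw [hμ.poissonIntegral_eq hz1, mul_div_cancel₀ _ (pow_ne_zero 2 hne.ne')]
        linarith [sq_nonneg ‖φ.eval z‖]
      calc ENNReal.ofReal (‖(α : ℂ) - φ.eval z‖ ^ 2) *
            μ {ζ : Circle | (ζ : ℂ) ∈ Metric.closedBall (ω : ℂ) (1 - ‖z‖)}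
          ≤ ENNReal.ofReal (‖(α : ℂ) - φ.eval z‖ ^ 2) *
            ENNReal.ofReal ((C + 1) ^ 2 * (1 - ‖z‖) * poissonIntegral μ z) := by gcongr
        _ = ENNReal.ofReal ((C + 1) ^ 2 * (1 - ‖z‖) *
              (‖(α : ℂ) - φ.eval z‖ ^ 2 * poissonIntegral μ z)) := by
            rw [← ENNReal.ofReal_mul (sq_nonneg _)]
            congr 1
            ring
        _ ≤ ENNReal.ofReal ((C + 1) ^ 2 * (1 - ‖z‖)) := by
            refine ENNReal.ofReal_le_ofReal (mul_le_of_le_one_right ?_ hPα)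
            exact mul_nonneg (sq_nonneg _) (by linarith)
        _ = ENNReal.ofReal ((C + 1) ^ 2) * ENNReal.ofReal (1 - ‖z‖) :=
            ENNReal.ofReal_mul (sq_nonneg _)
        _ ≤ ENNReal.ofReal ((C + 1) ^ 2) * (ENNReal.ofReal (2 * Real.pi) *
              circleLebesgue {ζ : Circle | (ζ : ℂ) ∈ Metric.closedBall (ω : ℂ) (1 - ‖z‖)}) := by
            gcongr
        _ = _ := (mul_assoc _ _ _).symm
  have h4 : Tendsto (fun z => ‖(α : ℂ) - φ.eval z‖ ^ 2) (𝓝[approachRegion C ω] (ω : ℂ))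
      (𝓝 0) := by
    have h := (ENNReal.tendsto_toReal ENNReal.zero_ne_top).comp h3
    refine h.congr fun z => ?_
    exact ENNReal.toReal_ofReal (sq_nonneg _)
  have h5 : Tendsto (fun z => ‖φ.eval z - α‖) (𝓝[approachRegion C ω] (ω : ℂ)) (𝓝 0) := by
    have h := h4.sqrt
    rw [Real.sqrt_zero] at h
    refine h.congr fun z => ?_
    rw [Real.sqrt_sq (norm_nonneg _), norm_sub_rev]
  exact tendsto_iff_norm_sub_tendsto_zero.mpr h5

end Clark

/-! ### Fourier monomials in the space of the Clark measure -/

/-- The character `ζ ↦ ζ ^ k`, `k` an integer, as a continuous function on the circle. -/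
noncomputable def circleCharacter (k : ℤ) : C(Circle, ℂ) :=
  ⟨fun ζ => ((ζ ^ k : Circle) : ℂ), by
    have h : Continuous fun ζ : Circle => (ζ : ℂ) := by fun_prop
    exact h.comp (continuous_zpow k)⟩

theorem circleCharacter_apply (k : ℤ) (ζ : Circle) :
    circleCharacter k ζ = ((ζ ^ k : Circle) : ℂ) := rfl

theorem monomialL2_eq_toLp (μ : Measure Circle) [IsFiniteMeasure μ] :
    monomialL2 μ = fun n : ℕ => ContinuousMap.toLp 2 μ ℂ (circleCharacter n) := by
  funext n
  rw [monomialL2]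
  congr 1

theorem inner_circleCharacter (μ : Measure Circle) [IsFiniteMeasure μ] (i j : ℤ) :
    inner ℂ (ContinuousMap.toLp 2 μ ℂ (circleCharacter i))
      (ContinuousMap.toLp 2 μ ℂ (circleCharacter j)) = circleMoment μ (j - i) := by
  rw [ContinuousMap.inner_toLp]
  refine integral_congr_ae (Eventually.of_forall fun ζ => ?_)
  simp only [circleCharacter_apply]
  rw [← Circle.coe_inv_eq_conj, ← Circle.coe_mul, ← zpow_neg, ← zpow_add, sub_eq_add_neg]

/-- Trigonometric polynomials are dense in `L²(μ)`, by the Stone-Weierstrass theorem. -/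
theorem dense_span_circleCharacter (μ : Measure Circle) [IsFiniteMeasure μ] :
    Dense (Submodule.span ℂ (Set.range fun k : ℤ =>
      ContinuousMap.toLp 2 μ ℂ (circleCharacter k)) : Set (Lp ℂ 2 μ)) := by
  set A : StarSubalgebra ℂ C(Circle, ℂ) :=
    { toSubalgebra := Algebra.adjoin ℂ (Set.range circleCharacter)
      star_mem' := by
        change Algebra.adjoin ℂ (Set.range circleCharacter) ≤
          star (Algebra.adjoin ℂ (Set.range circleCharacter))
        refine Algebra.adjoin_le ?_
        rintro _ ⟨k, rfl⟩
        refine Algebra.subset_adjoin ⟨-k, ?_⟩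
        ext ζ
        rw [ContinuousMap.star_apply, circleCharacter_apply, circleCharacter_apply, zpow_neg,
          Circle.coe_inv_eq_conj]
        rfl } with hA
  have hsep : A.SeparatesPoints := by
    intro x y hxy
    refine ⟨_, ⟨circleCharacter 1, Algebra.subset_adjoin ⟨1, rfl⟩, rfl⟩, ?_⟩
    simp only [circleCharacter_apply, zpow_one]
    exact fun h => hxy (Circle.ext h)
  have hspan : Subalgebra.toSubmodule A.toSubalgebra =
      Submodule.span ℂ (Set.range circleCharacter) := by
    refine Algebra.adjoin_eq_span_of_subset ℂ (fun f hf => ?_)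
    refine Submodule.subset_span ?_
    induction hf using Submonoid.closure_induction with
    | mem f hf => exact hf
    | one => exact ⟨0, by ext ζ; simp [circleCharacter_apply]⟩
    | mul f g _ _ hf hg =>
      obtain ⟨i, rfl⟩ := hf
      obtain ⟨j, rfl⟩ := hg
      refine ⟨i + j, ?_⟩
      ext ζ
      rw [ContinuousMap.mul_apply, circleCharacter_apply, circleCharacter_apply,
        circleCharacter_apply, zpow_add, Circle.coe_mul]
  have htop : (Submodule.span ℂ (Set.range circleCharacter)).topologicalClosure = ⊤ := by
    rw [← hspan]
    exact congrArg (Subalgebra.toSubmodule <| StarSubalgebra.toSubalgebra ·)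
      (ContinuousMap.starSubalgebra_topologicalClosure_eq_top_of_separatesPoints A hsep)
  have h := (ContinuousMap.toLp_denseRange ℂ μ ℂ
    (ENNReal.ofNat_ne_top (n := 2))).topologicalClosure_map_submodule htop
  rw [Submodule.map_span, ← Set.range_comp] at h
  rw [Submodule.dense_iff_topologicalClosure_eq_top]
  exact h

/-! ### The Kaczmarz sequence of a Clark measure -/

section Clark

variable {φ : HardySpace} {α : Circle} {μ : Measure Circle} [IsFiniteMeasure μ]

theorem IsClarkMeasure.circleMoment_zero (hμ : IsClarkMeasure φ.eval α μ) (hφ0 : φ.eval 0 = 0) :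
    circleMoment μ 0 = 1 := by
  have h := hμ.measureReal_univ hφ0
  simp [circleMoment, h]

theorem IsClarkMeasure.isParsevalFrame (hφ : IsInnerFunction φ) (hφ0 : φ.eval 0 = 0)
    (hμ : IsClarkMeasure φ.eval α μ) : IsParsevalFrame (kaczmarzSequence (monomialL2 μ)) := by
  rw [monomialL2_eq_toLp]
  refine isParsevalFrame_kaczmarzSequence_of_stationary
    (e := fun k : ℤ => ContinuousMap.toLp 2 μ ℂ (circleCharacter k))
    (inner_circleCharacter μ) (hμ.circleMoment_zero hφ0)
    (hμ.sum_mul_circleMoment hφ0) ?_ (dense_span_circleCharacter μ)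
  have h := (hasSum_nat_add_iff' 1).mpr (lp.hasSum_norm_sq φ)
  rw [hφ.norm_eq_one fun z hz => hμ.norm_eval_lt_one hφ0 hz] at h
  simpa [HardySpace.coeff_zero_eq_zero hφ0, norm_mul, Circle.norm_coe] using h

/-- Up to a null set, the Kaczmarz sequence is what the formula for `P_φ zⁿ` gives at `φ = α`. -/
theorem IsClarkMeasure.ae_kaczmarzSequence_eq (hφ0 : φ.eval 0 = 0)
    (hμ : IsClarkMeasure φ.eval α μ) (n : ℕ) :
    ∀ᵐ ζ : Circle ∂μ, kaczmarzSequence (monomialL2 μ) n ζ =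
      (ζ : ℂ) ^ n - α * ∑ k ∈ Finset.range (n + 1), starRingEnd ℂ (φ k) * (ζ : ℂ) ^ (n - k) := by
  set P : C(Circle, ℂ) := circleCharacter n - ∑ k ∈ Finset.range n,
    starRingEnd ℂ (starRingEnd ℂ (α : ℂ) * φ (k + 1)) • circleCharacter ((n - 1 - k : ℕ) : ℤ)
    with hP
  have h1 : kaczmarzSequence (monomialL2 μ) n = ContinuousMap.toLp 2 μ ℂ P := by
    rw [monomialL2_eq_toLp, kaczmarzSequence_eq_of_stationary
      (e := fun k : ℤ => ContinuousMap.toLp 2 μ ℂ (circleCharacter k))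
      (inner_circleCharacter μ) (hμ.circleMoment_zero hφ0) (hμ.sum_mul_circleMoment hφ0), hP,
      map_sub, map_sum]
    simp only [map_smul]
  rw [h1]
  filter_upwards [ContinuousMap.coeFn_toLp (p := 2) (𝕜 := ℂ) μ P] with ζ hζ
  rw [hζ, Finset.sum_range_succ', HardySpace.coeff_zero_eq_zero hφ0, map_zero, zero_mul, add_zero,
    hP, ContinuousMap.sub_apply, ContinuousMap.sum_apply, Finset.mul_sum]
  congr 1
  refine Finset.sum_congr rfl fun k _ => ?_
  rw [ContinuousMap.smul_apply, circleCharacter_apply, zpow_natCast, Circle.coe_pow, map_mul,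
    Complex.conj_conj, smul_eq_mul, Nat.sub_sub, Nat.add_comm 1 k, mul_assoc]

end Clark

theorem mainTheorem2 (φ : HardySpace) (hφ : IsInnerFunction φ) (hφ0 : φ.eval 0 = 0)
    (α : Circle) (μ : Measure Circle) [IsFiniteMeasure μ] (hμ : IsClarkMeasure φ.eval α μ) :
    IsParsevalFrame (kaczmarzSequence (monomialL2 μ)) ∧
    ∀ n : ℕ, ∀ᵐ ζ ∂μ,
      HasNontangentialLimit (modelProjection φ (HardySpace.monomial n)).eval ζ
        (kaczmarzSequence (monomialL2 μ) n ζ) := by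
  refine ⟨hμ.isParsevalFrame hφ hφ0, fun n => ?_⟩
  have hb : ∀ z, ‖z‖ < 1 → ‖φ.eval z‖ < 1 := fun z hz => hμ.norm_eval_lt_one hφ0 hz
  filter_upwards [hμ.ae_hasNontangentialLimit hφ hφ0, hμ.ae_kaczmarzSequence_eq hφ0 n]
    with ζ hlim hζ C
  rw [hζ]
  have hpow : ∀ k : ℕ, Tendsto (fun z : ℂ => z ^ k) (𝓝[approachRegion C ζ] (ζ : ℂ))
      (𝓝 ((ζ : ℂ) ^ k)) := fun k =>
    ((continuous_pow k).tendsto _).mono_left nhdsWithin_le_nhds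
  have h := (hpow n).sub ((hlim C).mul (tendsto_finsetSum (Finset.range (n + 1)) fun k _ =>
    (hpow (n - k)).const_mul (starRingEnd ℂ (φ k))))
  refine h.congr' ?_
  filter_upwards [eventually_mem_nhdsWithin] with z hz
  rw [eval_modelProjection_monomial (fun z hz => (hb z hz).le) (hφ.norm_eq_one hb) n hz.1]
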